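/- **Setting.** Fix $d,p,s\ge 0$ and $r_1,\dots,r_p\ge 0$. A causal $\mathrm{VAR}(p)$ process is a zero-mean, square-integrable, strictly stationary $\mathbb R^d$-valued process $(X_t)_{t\in\mathbb Z}$ with $X_t=A_1X_{t-1}+\cdots+A_pX_{t-p}+Z_t$, where the $Z_t$ are independent $N(0,\Sigma)$, $\Sigma$ is positive definite, and all roots of $\det(I-A_1z-\cdots-A_pz^p)$ lie outside the closed unit disc; processes are identified with their laws. Put $\Gamma(h)=E[X_tX_{t-h}^{\mathsf T}]$ and $\Gamma(-h)=\Gamma(h)^{\mathsf T}$, and let $\Upsilon_{j-1}=[\Gamma(k-i)]_{0\le i,k\le j-1}$ be the covariance matrix of $(X_t,\dots,X_{t-j+1})$, $$\xi_j^{\mathsf T}=(\Gamma(1),\dots,\Gamma(j)),\qquad \kappa_j^{\mathsf T}=(\Gamma(j)^{\mathsf T},\dots,\Gamma(1)^{\mathsf T}),$$ $$C_j=\Gamma(0)-\xi_j^{\mathsf T}\Upsilon_{j-1}^{-1}\xi_j,\qquad D_j=\Gamma(0)-\kappa_j^{\mathsf T}\Upsilon_{j-1}^{-1}\kappa_j,\qquad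 W_j=\Gamma(j)-\xi_{j-1}^{\mathsf T}\Upsilon_{j-2}^{-1}\kappa_{j-1},$$ with $C_0=D_0=\Gamma(0)$ and $W_1=\Gamma(1)$. A positive definite $\Omega$ is $s$-sparse if in its modified Cholesky decomposition $\Omega=(I-E)F(I-E)^{\mathsf T}$ ($E$ strictly lower triangular, $F$ positive diagonal) $E$ has at most $s$ nonzero entries. Given $\Omega>0$ and $d\times r_j$ matrices $U_j,V_j$ $(1\le j\le p)$, define $\Gamma(0)=\Omega^{-1}$ and recursively $\Gamma(j)=U_jV_j^{\mathsf T}+\xi_{j-1}^{\mathsf T}\Upsilon_{j-2}^{-1}\kappa_{j-1}$; the matrices $C_{j-1},D_{j-1}$ formed from these depend only on $\Omega$ and the pairs of index less than $j$. **(1)** Let $\Omega$ be positive definite and $s$-sparse, let all $U_j,V_j$ have full column rank $r_j$, and suppose that $(U_jV_j^{\mathsf T})D_{j-1}^{-1}(U_jV_j^{\mathsf T})^{\mathsf T}<C_{j-1}$ in the Loewner order for every $j$ (when $V_j^{\mathsf T}D_{j-1}^{-1}V_j=I$ this says $U_j^{\mathsf T}C_{j-1}^{-1}U_j<I$). Then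 there is a unique causal $\mathrm{VAR}(p)$ process (unique law, coefficients $A_1,\dots,A_p$ and innovation variance $\Sigma$) with $\Gamma(0)=\Omega^{-1}$ and $W_j=U_jV_j^{\mathsf T}$ for $j=1,\dots,p$. Its autocovariances $\Gamma(0),\dots,\Gamma(p)$ are those given by the recursion, $(A_1,\dots,A_p)=\xi_p^{\mathsf T}\Upsilon_{p-1}^{-1}$, $\Sigma=C_p$, and $C_j^{-1}-C_{j-1}^{-1}$ has rank $r_j$ for each $j$. **(2)** Conversely, for every causal $\mathrm{VAR}(p)$ process such that $\Gamma(0)^{-1}$ is $s$-sparse and $C_j^{-1}-C_{j-1}^{-1}$ has rank $r_j$ for each $j$, there are for each $j$ matrices $U_j,V_j$ of order $d\times r_j$ with $W_j=U_jV_j^{\mathsf T}$ and $V_j^{\mathsf T}D_{j-1}^{-1}V_j=I$; they have rank $r_j$, they satisfy $U_j^{\mathsf T}C_{j-1}^{-1}U_j<I$, and the pairs $(U_j',V_j')$ with these two properties ($W_j=U_j'V_j'^{\mathsf T}$ and $V_j'^{\mathsf T}D_{j-1}^{-1}V_j'=I$) are exactly the pairs $(U_jQ,V_jQ)$ with $Q$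 an $r_j\times r_j$ orthogonal matrix. **(3)** Consider the tuples $(\Omega,(U_1,V_1),\dots,(U_p,V_p))$ with $\Omega$ positive definite and $s$-sparse, $U_j,V_j$ of full column rank $r_j$, $V_j^{\mathsf T}D_{j-1}^{-1}V_j=I$ and $U_j^{\mathsf T}C_{j-1}^{-1}U_j<I$ for all $j$, modulo the relation $(U_j,V_j)\equiv(U_jQ_j,V_jQ_j)$ with $Q_j$ orthogonal. The map sending a tuple to $\big((A_1,\dots,A_p),\Sigma\big)=\big(\xi_p^{\mathsf T}\Upsilon_{p-1}^{-1},\,C_p\big)$ induces a bijection from the set of equivalence classes onto the set of parameters $\big((A_1,\dots,A_p),\Sigma\big)$ of the causal $\mathrm{VAR}(p)$ processes for which $\Gamma(0)^{-1}$ is $s$-sparse and $C_j^{-1}-C_{j-1}^{-1}$ has rank $r_j$ for each $j$. -/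

import Mathlib

open MeasureTheory ProbabilityTheory
open scoped Matrix

noncomputable section

/-! ### Block matrices built from an autocovariance sequence

Throughout, `γ h` plays the role of `Γ(h) = E[X_t X_{t-h}ᵀ]`, and block indices start at `0`. -/

namespace VAR

/-- The covariance matrix of the `n` consecutive observations `(X_t, X_{t-1}, …, X_{t-n+1})`:
the `(i, k)` block is `γ (k - i)` for `i ≤ k` and `γ (i - k)ᵀ` for `i > k`. This is `Υ_{n-1}`. -/
def toeplitz {d : ℕ} (γ : ℕ → Matrix (Fin d) (Fin d) ℝ) (n : ℕ) :
    Matrix (Fin n × Fin d) (Fin n × Fin d) ℝ :=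
  Matrix.of fun a b =>
    if a.1 ≤ b.1 then γ (b.1.val - a.1.val) a.2 b.2 else γ (a.1.val - b.1.val) b.2 a.2

/-- `ξ_n`, with `ξ_nᵀ = (γ 1, γ 2, …, γ n)`. -/
def xi {d : ℕ} (γ : ℕ → Matrix (Fin d) (Fin d) ℝ) (n : ℕ) :
    Matrix (Fin n × Fin d) (Fin d) ℝ :=
  Matrix.of fun a b => γ (a.1.val + 1) b a.2

/-- `κ_n`, with `κ_nᵀ = ((γ n)ᵀ, …, (γ 2)ᵀ, (γ 1)ᵀ)`. -/
def kappa {d : ℕ} (γ : ℕ → Matrix (Fin d) (Fin d) ℝ) (n : ℕ) :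
    Matrix (Fin n × Fin d) (Fin d) ℝ :=
  Matrix.of fun a b => γ (n - a.1.val) a.2 b

/-- `C_n = γ 0 - ξ_nᵀ Υ_{n-1}⁻¹ ξ_n`, the forward conditional dispersion matrix; `C_0 = γ 0`. -/
def condC {d : ℕ} (γ : ℕ → Matrix (Fin d) (Fin d) ℝ) (n : ℕ) : Matrix (Fin d) (Fin d) ℝ :=
  γ 0 - (xi γ n)ᵀ * (toeplitz γ n)⁻¹ * xi γ n

/-- `D_n = γ 0 - κ_nᵀ Υ_{n-1}⁻¹ κ_n`, the backward conditional dispersion matrix; `D_0 = γ 0`. -/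
def condD {d : ℕ} (γ : ℕ → Matrix (Fin d) (Fin d) ℝ) (n : ℕ) : Matrix (Fin d) (Fin d) ℝ :=
  γ 0 - (kappa γ n)ᵀ * (toeplitz γ n)⁻¹ * kappa γ n

/-- `ξ_nᵀ Υ_{n-1}⁻¹ κ_n`, the part of `γ (n + 1)` explained by the `n` intermediate
observations. It only involves `γ 0, …, γ n`. -/
def predCov {d : ℕ} (γ : ℕ → Matrix (Fin d) (Fin d) ℝ) (n : ℕ) : Matrix (Fin d) (Fin d) ℝ :=
  (xi γ n)ᵀ * (toeplitz γ n)⁻¹ * kappa γ n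

/-- `partialCov γ n` is `W_{n+1} = γ (n + 1) - ξ_nᵀ Υ_{n-1}⁻¹ κ_n`; `partialCov γ 0 = γ 1`. -/
def partialCov {d : ℕ} (γ : ℕ → Matrix (Fin d) (Fin d) ℝ) (n : ℕ) : Matrix (Fin d) (Fin d) ℝ :=
  γ (n + 1) - predCov γ n

/-- The Yule-Walker coefficients `(A_1, …, A_p) = ξ_pᵀ Υ_{p-1}⁻¹`
(`yuleWalker γ p k` is `A_{k+1}`). -/
def yuleWalker {d : ℕ} (γ : ℕ → Matrix (Fin d) (Fin d) ℝ) (p : ℕ) (k : Fin p) :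
    Matrix (Fin d) (Fin d) ℝ :=
  Matrix.of fun a b => ((xi γ p)ᵀ * (toeplitz γ p)⁻¹) a (k, b)

/-- Auxiliary recursion: `recTable Ω W n` holds the autocovariances of lags `0, …, n` computed
from `γ 0 = Ω⁻¹` and `γ (m + 1) = W m + ξ_mᵀ Υ_{m-1}⁻¹ κ_m`. -/
def recTable {d : ℕ} (Ω : Matrix (Fin d) (Fin d) ℝ) (W : ℕ → Matrix (Fin d) (Fin d) ℝ) :
    ℕ → ℕ → Matrix (Fin d) (Fin d) ℝ
  | 0 => fun _ => Ω⁻¹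
  | n + 1 => Function.update (recTable Ω W n) (n + 1) (W n + predCov (recTable Ω W n) n)

/-- The autocovariances determined recursively from `Ω` and the matrices `W_{m+1} = W m`. -/
def recAutocov {d : ℕ} (Ω : Matrix (Fin d) (Fin d) ℝ) (W : ℕ → Matrix (Fin d) (Fin d) ℝ)
    (h : ℕ) : Matrix (Fin d) (Fin d) ℝ :=
  recTable Ω W h h

/-! ### Causal VAR processes -/

/-- `Z_t = X_t - A_1 X_{t-1} - ⋯ - A_p X_{t-p}` along a path `x` (`A k` is `A_{k+1}`). -/
def innovation {d p : ℕ} (A : Fin p → Matrix (Fin d) (Fin d) ℝ) (t : ℤ)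
    (x : ℤ → EuclideanSpace ℝ (Fin d)) : EuclideanSpace ℝ (Fin d) :=
  x t - ∑ k : Fin p, Matrix.toEuclideanCLM (𝕜 := ℝ) (A k) (x (t - ((k : ℕ) + 1 : ℕ)))

/-- `P` is the law, on the space of paths `x : ℤ → ℝ^d`, of a zero mean stationary causal
`VAR(p)` process `X_t = A_1 X_{t-1} + ⋯ + A_p X_{t-p} + Z_t`, where the `Z_t` are independent
`N(0, S)` with `S` positive definite. Causality: all roots of
`det (I - A_1 z - ⋯ - A_p z^p)` lie outside the closed unit disc. -/
structure IsCausalVAR {d p : ℕ} (A : Fin p → Matrix (Fin d) (Fin d) ℝ)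
    (S : Matrix (Fin d) (Fin d) ℝ) (P : Measure (ℤ → EuclideanSpace ℝ (Fin d))) : Prop where
  isProbabilityMeasure : IsProbabilityMeasure P
  memLp_two : ∀ t : ℤ, MemLp (fun x : ℤ → EuclideanSpace ℝ (Fin d) => x t) 2 P
  mean_zero : ∀ t : ℤ, ∫ x, x t ∂P = 0
  stationary : ∀ h : ℤ,
    P.map (fun (x : ℤ → EuclideanSpace ℝ (Fin d)) (t : ℤ) => x (t + h)) = P
  posDef : S.PosDef
  innovation_law : ∀ t : ℤ, P.map (innovation A t) = multivariateGaussian 0 S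
  innovation_indep : iIndepFun (fun t : ℤ => innovation A t) P
  causal : ∀ z : ℂ, ‖z‖ ≤ 1 →
    (1 - ∑ k : Fin p, z ^ ((k : ℕ) + 1) • (A k).map ((↑) : ℝ → ℂ)).det ≠ 0

/-- The lag-`h` autocovariance matrix `Γ(h) = E[(X_t - E X_t) (X_{t-h} - E X_{t-h})ᵀ]`, at `t = 0`
(it does not depend on `t` for a stationary process). -/
def autocov {d : ℕ} (P : Measure (ℤ → EuclideanSpace ℝ (Fin d))) (h : ℕ) :
    Matrix (Fin d) (Fin d) ℝ :=
  Matrix.of fun a b => cov[fun x => x 0 a, fun x => x (-(h : ℤ)) b; P]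

/-! ### Parameters -/

/-- `Ω` is `s`-sparse: in its modified Cholesky decomposition `Ω = (I - E) F (I - E)ᵀ`, with `E`
strictly lower triangular and `F` diagonal with positive entries, `E` has at most `s` nonzero
entries. -/
def IsSparse {d : ℕ} (s : ℕ) (Ω : Matrix (Fin d) (Fin d) ℝ) : Prop :=
  ∃ (E : Matrix (Fin d) (Fin d) ℝ) (f : Fin d → ℝ),
    (∀ i j, i ≤ j → E i j = 0) ∧ (∀ i, 0 < f i) ∧
    Ω = (1 - E) * Matrix.diagonal f * (1 - E)ᵀ ∧
    {ij : Fin d × Fin d | E ij.1 ij.2 ≠ 0}.ncard ≤ s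

/-- A tuple `(Ω, (U_1, V_1), …, (U_p, V_p))` with `U_j, V_j` of order `d × r_j`
(`U j`, `V j` are `U_{j+1}`, `V_{j+1}`). -/
structure FactorParam (d p : ℕ) (r : Fin p → ℕ) where
  Ω : Matrix (Fin d) (Fin d) ℝ
  U : (j : Fin p) → Matrix (Fin d) (Fin (r j)) ℝ
  V : (j : Fin p) → Matrix (Fin d) (Fin (r j)) ℝ

/-- The autocovariances determined recursively from `Γ(0) = Ω⁻¹` and `W_j = U_j V_jᵀ`
(only the lags `0, …, p` matter). -/
def FactorParam.autocov {d p : ℕ} {r : Fin p → ℕ} (θ : FactorParam d p r) :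
    ℕ → Matrix (Fin d) (Fin d) ℝ :=
  recAutocov θ.Ω fun m => if h : m < p then θ.U ⟨m, h⟩ * (θ.V ⟨m, h⟩)ᵀ else 0

/-- `Ω` is positive definite and `s`-sparse, the `U_j` and `V_j` have full column rank, and
`W_j D_{j-1}⁻¹ W_jᵀ < C_{j-1}` in the Loewner order for `W_j = U_j V_jᵀ`, where `C_{j-1}` and
`D_{j-1}` are computed from `Ω` and the pairs of index less than `j`. For pairs normalized by
`V_jᵀ D_{j-1}⁻¹ V_j = I` the inequality reads `U_j U_jᵀ < C_{j-1}`, i.e. `U_jᵀ C_{j-1}⁻¹ U_j < I`. -/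
structure FactorParam.IsFeasible {d p : ℕ} {r : Fin p → ℕ} (s : ℕ) (θ : FactorParam d p r) :
    Prop where
  posDef : θ.Ω.PosDef
  sparse : IsSparse s θ.Ω
  rank_U : ∀ j, (θ.U j).rank = r j
  rank_V : ∀ j, (θ.V j).rank = r j
  contraction : ∀ j : Fin p, (condC θ.autocov j -
    (θ.U j * (θ.V j)ᵀ) * (condD θ.autocov j)⁻¹ * (θ.U j * (θ.V j)ᵀ)ᵀ).PosDef

/-- `Ω` is positive definite and `s`-sparse, the `U_j` and `V_j` have full column rank, and they
satisfy the restrictions `V_jᵀ D_{j-1}⁻¹ V_j = I` and `U_jᵀ C_{j-1}⁻¹ U_j < I`, where `C_{j-1}` and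
`D_{j-1}` are computed from `Ω` and the pairs of index less than `j`. -/
structure FactorParam.IsAdmissible {d p : ℕ} {r : Fin p → ℕ} (s : ℕ) (θ : FactorParam d p r) :
    Prop where
  posDef : θ.Ω.PosDef
  sparse : IsSparse s θ.Ω
  rank_U : ∀ j, (θ.U j).rank = r j
  rank_V : ∀ j, (θ.V j).rank = r j
  normalized : ∀ j : Fin p, (θ.V j)ᵀ * (condD θ.autocov j)⁻¹ * θ.V j = 1
  contraction : ∀ j : Fin p, (1 - (θ.U j)ᵀ * (condC θ.autocov j)⁻¹ * θ.U j).PosDef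

/-- Equivalence up to rotation: same `Ω`, and `(U_j', V_j') = (U_j Q_j, V_j Q_j)` with `Q_j`
orthogonal, for every `j`. -/
def rotationSetoid (d p : ℕ) (r : Fin p → ℕ) (s : ℕ) :
    Setoid {θ : FactorParam d p r // θ.IsAdmissible s} where
  r θ θ' := θ'.1.Ω = θ.1.Ω ∧ ∀ j, ∃ Q ∈ Matrix.orthogonalGroup (Fin (r j)) ℝ,
    θ'.1.U j = θ.1.U j * Q ∧ θ'.1.V j = θ.1.V j * Q
  iseqv :=
    { refl := fun _ => ⟨rfl, fun _ => ⟨1, one_mem _, by simp, by simp⟩⟩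
      symm := by
        rintro θ θ' ⟨h0, h⟩
        refine ⟨h0.symm, fun j => ?_⟩
        obtain ⟨Q, hQ, hU, hV⟩ := h j
        have hQ' := (Matrix.mem_orthogonalGroup_iff (Fin (r j)) ℝ).1 hQ
        refine ⟨Qᵀ, (Matrix.mem_orthogonalGroup_iff' (Fin (r j)) ℝ).2 (by simpa using hQ'), ?_, ?_⟩
        · rw [hU, Matrix.mul_assoc, hQ', Matrix.mul_one]
        · rw [hV, Matrix.mul_assoc, hQ', Matrix.mul_one]
      trans := by
        rintro θ θ' θ'' ⟨h0, h⟩ ⟨h0', h'⟩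
        refine ⟨h0'.trans h0, fun j => ?_⟩
        obtain ⟨Q, hQ, hU, hV⟩ := h j
        obtain ⟨Q', hQ', hU', hV'⟩ := h' j
        exact ⟨Q * Q', mul_mem hQ hQ', by rw [hU', hU, Matrix.mul_assoc],
          by rw [hV', hV, Matrix.mul_assoc]⟩ }

/-- `P` is the law of a process with `s`-sparse stationary precision matrix `Γ(0)⁻¹` and
conditional precision increments `C_j⁻¹ - C_{j-1}⁻¹` of rank `r_j`, `j = 1, …, p`. -/
def HasStructure {d p : ℕ} (r : Fin p → ℕ) (s : ℕ)
    (P : Measure (ℤ → EuclideanSpace ℝ (Fin d))) : Prop :=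
  IsSparse s (autocov P 0)⁻¹ ∧
    ∀ j : Fin p, ((condC (autocov P) (j + 1))⁻¹ - (condC (autocov P) j)⁻¹).rank = r j

/-- The parameters `((A_1, …, A_p), Σ)` of the causal `VAR(p)` processes with `s`-sparse
stationary precision matrix and conditional precision increments of ranks `r_1, …, r_p`. -/
def causalParams (d p : ℕ) (r : Fin p → ℕ) (s : ℕ) :
    Set ((Fin p → Matrix (Fin d) (Fin d) ℝ) × Matrix (Fin d) (Fin d) ℝ) :=
  {AS | ∃ P, IsCausalVAR AS.1 AS.2 P ∧ HasStructure r s P}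

end VAR

end

/-! The bridge between parameters and processes is the block Toeplitz covariance matrix `T =
toeplitz γ (p + 1)` of `(X_t, …, X_{t-p})`: lists `Γ(0), …, Γ(p)` with `T` positive definite
correspond to causal VAR(p) processes, and the same lists have `Γ(0)` and `W_1, …, W_p` as
coordinates.

Algebra. Splitting off one block and taking Schur complements, `toeplitz γ (n + 1)` is positive
definite iff `toeplitz γ n` and `C_n` are (`posDef_toeplitz_succ_iff_condC`), and `C_{n+1} = C_n -
W_{n+1} D_n⁻¹ W_{n+1}ᵀ` (`condC_succ`). Hence positivity of `T` amounts to `Γ(0) > 0` together with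
the contraction inequality for every `W_j`, and `C_j⁻¹ - C_{j-1}⁻¹` has the rank of `W_j`
(`rank_condC_inv_sub`). A rank factorization `W_j = U_j V_jᵀ` with `V_jᵀ D_{j-1}⁻¹ V_j = I` is
unique up to rotation (`normalized_factorization_iff`) and turns the contraction into `U_j U_jᵀ <
C_{j-1}`, that is `U_jᵀ C_{j-1}⁻¹ U_j < I`.

Processes. With `F` the companion matrix of the state `(X_t, …, X_{t-p})`, the Yule-Walker equations
give the Lyapunov equation `T = F T Fᵀ + S`, with `S` placed in the first block. If the polynomial
is causal then `Fⁿ → 0`, so the solution is unique and positive definite (`IsLyapunov.unique`,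
`IsLyapunov.posDef`); conversely a positive definite solution forces causality
(`IsLyapunov.isCausalPoly`). Finally `(A, S)` determines the law: the moving average filter and the
innovation map are almost surely inverse to each other, so a causal process is the image of Gaussian
noise (`IsCausalVAR.eq_causalLaw`). A positive definite `T` is therefore realized by the process
with its Yule-Walker parameters, and by no other (`exists_isCausalVAR_of_posDef`,
`IsCausalVAR.eq_of_autocov_eq`). -/

noncomputable section

/-! ### Schur complements -/

namespace Matrix

variable {m n : Type*} [Fintype m] [Fintype n] [DecidableEq m] [DecidableEq n]

/-- Schur complement criterion for positive definiteness. -/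
theorem posDef_fromBlocks_iff (A : Matrix m m ℝ) (B : Matrix m n ℝ) (D : Matrix n n ℝ) :
    (fromBlocks A B Bᵀ D).PosDef ↔ A.PosDef ∧ (D - Bᵀ * A⁻¹ * B).PosDef := by
  -- Positive definite means positive semidefinite and invertible; for invertible `A` both
  -- properties pass between the block matrix and its Schur complement.
  have key : A.PosDef → ((fromBlocks A B Bᵀ D).PosDef ↔ (D - Bᵀ * A⁻¹ * B).PosDef) := by
    intro hA
    have : Invertible A := hA.isUnit.invertible
    have h1 := PosDef.fromBlocks₁₁ B D hA
    have h2 := isUnit_fromBlocks_iff_of_invertible₁₁ (A := A) (B := B) (C := Bᵀ) (D := D)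
    rw [conjTranspose_eq_transpose_of_trivial] at h1
    rw [invOf_eq_nonsing_inv] at h2
    constructor
    · intro h
      exact (h1.1 h.posSemidef).posDef_iff_isUnit.2 (h2.1 h.isUnit)
    · intro h
      exact (h1.2 h.posSemidef).posDef_iff_isUnit.2 (h2.2 h.isUnit)
  constructor
  · intro h
    have hA : A.PosDef := by
      have := h.submatrix (e := (Sum.inl : m → m ⊕ n)) Sum.inl_injective
      rwa [show (fromBlocks A B Bᵀ D).submatrix Sum.inl Sum.inl = A from rfl] at this
    exact ⟨hA, (key hA).1 h⟩
  · rintro ⟨hA, h⟩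
    exact (key hA).2 h

/-- A quadratic form in the inverse of a block matrix, by completion of the square. -/
theorem transpose_fromRows_mul_inv_fromBlocks_mul {l : Type*} (A : Matrix m m ℝ)
    (B : Matrix m n ℝ) (D : Matrix n n ℝ) (h : (fromBlocks A B Bᵀ D).PosDef)
    (x : Matrix m l ℝ) (y : Matrix n l ℝ) :
    (fromRows x y)ᵀ * (fromBlocks A B Bᵀ D)⁻¹ * fromRows x y =
      xᵀ * A⁻¹ * x + (y - Bᵀ * A⁻¹ * x)ᵀ * (D - Bᵀ * A⁻¹ * B)⁻¹ * (y - Bᵀ * A⁻¹ * x) := by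
  obtain ⟨hA, hS⟩ := (posDef_fromBlocks_iff A B D).1 h
  have hAu := (isUnit_iff_isUnit_det _).1 hA.isUnit
  have hSu := (isUnit_iff_isUnit_det _).1 hS.isUnit
  have hMu := (isUnit_iff_isUnit_det _).1 h.isUnit
  have hAt : Aᵀ = A := by
    simpa [conjTranspose_eq_transpose_of_trivial] using hA.isHermitian.eq
  set S := D - Bᵀ * A⁻¹ * B with hSdef
  -- Block elimination: `w` is the second component of the solution of the linear system with
  -- right-hand side `(x, y)`.
  set w := S⁻¹ * (y - Bᵀ * A⁻¹ * x) with hw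
  have hSw : S * w = y - Bᵀ * A⁻¹ * x := by
    rw [hw, ← Matrix.mul_assoc, mul_nonsing_inv _ hSu, Matrix.one_mul]
  have hM : fromBlocks A B Bᵀ D * fromRows (A⁻¹ * (x - B * w)) w = fromRows x y := by
    rw [fromBlocks_mul_fromRows]
    congr 1
    · rw [← Matrix.mul_assoc, mul_nonsing_inv _ hAu, Matrix.one_mul, sub_add_cancel]
    · have : D = S + Bᵀ * A⁻¹ * B := by rw [hSdef, sub_add_cancel]
      rw [this, Matrix.add_mul, hSw]
      simp only [Matrix.mul_sub, Matrix.mul_assoc]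
      abel
  have hinv : (fromBlocks A B Bᵀ D)⁻¹ * fromRows x y = fromRows (A⁻¹ * (x - B * w)) w := by
    rw [← hM, ← Matrix.mul_assoc, nonsing_inv_mul _ hMu, Matrix.one_mul]
  rw [Matrix.mul_assoc, hinv, transpose_fromRows, fromCols_mul_fromRows]
  have hAit : (A⁻¹)ᵀ = A⁻¹ := by rw [transpose_nonsing_inv, hAt]
  simp only [transpose_sub, transpose_mul, hAit, transpose_transpose, Matrix.mul_sub,
    Matrix.sub_mul, Matrix.mul_assoc, hw]
  abel

theorem sub_transpose_fromRows_mul_inv_fromBlocks_mul {l : Type*} (A : Matrix m m ℝ)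
    (B : Matrix m n ℝ) (D : Matrix n n ℝ) (C : Matrix l l ℝ) (h : (fromBlocks A B Bᵀ D).PosDef)
    (x : Matrix m l ℝ) (y : Matrix n l ℝ) :
    C - (fromRows x y)ᵀ * (fromBlocks A B Bᵀ D)⁻¹ * fromRows x y =
      (C - xᵀ * A⁻¹ * x) -
        (y - Bᵀ * A⁻¹ * x)ᵀ * (D - Bᵀ * A⁻¹ * B)⁻¹ * (y - Bᵀ * A⁻¹ * x) := by
  rw [transpose_fromRows_mul_inv_fromBlocks_mul A B D h, sub_add_eq_sub_sub]

end Matrix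

/-! ### Positivity of block Toeplitz matrices and the Levinson update -/

namespace VAR

open Matrix

variable {d : ℕ}

/-- Splitting off the first of `n + 1` blocks. -/
def splitFirst (d n : ℕ) : (Fin n × Fin d) ⊕ Fin d ≃ Fin (n + 1) × Fin d where
  toFun := Sum.elim (fun a => (a.1.succ, a.2)) (fun b => (0, b))
  invFun a := Fin.cases (motive := fun _ => (Fin n × Fin d) ⊕ Fin d)
    (Sum.inr a.2) (fun i => Sum.inl (i, a.2)) a.1
  left_inv := by rintro (⟨i, a⟩ | b) <;> rfl
  right_inv := by
    rintro ⟨i, a⟩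
    induction i using Fin.cases <;> rfl

/-- Splitting off the last of `n + 1` blocks. -/
def splitLast (d n : ℕ) : (Fin n × Fin d) ⊕ Fin d ≃ Fin (n + 1) × Fin d where
  toFun := Sum.elim (fun a => (a.1.castSucc, a.2)) (fun b => (Fin.last n, b))
  invFun a := Fin.lastCases (motive := fun _ => (Fin n × Fin d) ⊕ Fin d)
    (Sum.inr a.2) (fun i => Sum.inl (i, a.2)) a.1
  left_inv := by rintro (⟨i, a⟩ | b) <;> simp
  right_inv := by
    rintro ⟨i, a⟩
    induction i using Fin.lastCases <;> simp

@[simp] theorem splitFirst_inl (n : ℕ) (a : Fin n × Fin d) :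
    splitFirst d n (Sum.inl a) = (a.1.succ, a.2) := rfl
@[simp] theorem splitFirst_inr (n : ℕ) (b : Fin d) :
    splitFirst d n (Sum.inr b) = (0, b) := rfl
@[simp] theorem splitLast_inl (n : ℕ) (a : Fin n × Fin d) :
    splitLast d n (Sum.inl a) = (a.1.castSucc, a.2) := rfl
@[simp] theorem splitLast_inr (n : ℕ) (b : Fin d) :
    splitLast d n (Sum.inr b) = (Fin.last n, b) := rfl

theorem toeplitz_submatrix_splitFirst (γ : ℕ → Matrix (Fin d) (Fin d) ℝ) (n : ℕ) :
    (toeplitz γ (n + 1)).submatrix (splitFirst d n) (splitFirst d n) =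
      fromBlocks (toeplitz γ n) (xi γ n) (xi γ n)ᵀ (γ 0) := by
  ext (⟨i, a⟩ | a) (⟨k, b⟩ | b) <;> simp [toeplitz, xi]

theorem toeplitz_submatrix_splitLast (γ : ℕ → Matrix (Fin d) (Fin d) ℝ) (n : ℕ) :
    (toeplitz γ (n + 1)).submatrix (splitLast d n) (splitLast d n) =
      fromBlocks (toeplitz γ n) (kappa γ n) (kappa γ n)ᵀ (γ 0) := by
  ext (⟨i, a⟩ | a) (⟨k, b⟩ | b)
  · simp [toeplitz]
  · simp [toeplitz, kappa, Fin.le_last]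
  · simp [toeplitz, kappa]
  · simp [toeplitz]

theorem xi_submatrix_splitLast (γ : ℕ → Matrix (Fin d) (Fin d) ℝ) (n : ℕ) :
    (xi γ (n + 1)).submatrix (splitLast d n) id = fromRows (xi γ n) (γ (n + 1))ᵀ := by
  ext (⟨i, a⟩ | a) b <;> simp [xi]

theorem posDef_submatrix_equiv_iff {m n : Type*} [Fintype m] [Fintype n] (e : m ≃ n)
    (M : Matrix n n ℝ) : (M.submatrix e e).PosDef ↔ M.PosDef := by
  refine ⟨fun h => ?_, fun h => h.submatrix e.injective⟩
  simpa using h.submatrix e.symm.injective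

theorem posDef_toeplitz_zero (γ : ℕ → Matrix (Fin d) (Fin d) ℝ) : (toeplitz γ 0).PosDef := by
  refine PosDef.of_dotProduct_mulVec_pos ?_ fun x hx => (hx (Subsingleton.elim _ _)).elim
  ext i
  exact i.1.elim0

/-- Removing the first or the last of `n + 1` consecutive observations leaves the same matrix
`toeplitz γ n`, by stationarity. The Schur complement is `C_n` in the first case and `D_n` in the
second. -/
theorem posDef_toeplitz_succ_iff_condC (γ : ℕ → Matrix (Fin d) (Fin d) ℝ) (n : ℕ) :
    (toeplitz γ (n + 1)).PosDef ↔ (toeplitz γ n).PosDef ∧ (condC γ n).PosDef := by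
  rw [← posDef_submatrix_equiv_iff (splitFirst d n), toeplitz_submatrix_splitFirst,
    posDef_fromBlocks_iff]
  rfl

theorem posDef_toeplitz_succ_iff_condD (γ : ℕ → Matrix (Fin d) (Fin d) ℝ) (n : ℕ) :
    (toeplitz γ (n + 1)).PosDef ↔ (toeplitz γ n).PosDef ∧ (condD γ n).PosDef := by
  rw [← posDef_submatrix_equiv_iff (splitLast d n), toeplitz_submatrix_splitLast,
    posDef_fromBlocks_iff]
  rfl

theorem posDef_toeplitz_of_le {γ : ℕ → Matrix (Fin d) (Fin d) ℝ} {m n : ℕ} (hmn : m ≤ n)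
    (h : (toeplitz γ n).PosDef) : (toeplitz γ m).PosDef := by
  induction n, hmn using Nat.le_induction with
  | base => exact h
  | succ n _ ih => exact ih ((posDef_toeplitz_succ_iff_condC γ n).1 h).1

theorem condC_posDef {γ : ℕ → Matrix (Fin d) (Fin d) ℝ} {n p : ℕ} (hn : n ≤ p)
    (h : (toeplitz γ (p + 1)).PosDef) : (condC γ n).PosDef :=
  ((posDef_toeplitz_succ_iff_condC γ n).1
    (posDef_toeplitz_of_le (Nat.succ_le_succ hn) h)).2

theorem condD_posDef {γ : ℕ → Matrix (Fin d) (Fin d) ℝ} {n p : ℕ} (hn : n ≤ p)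
    (h : (toeplitz γ (p + 1)).PosDef) : (condD γ n).PosDef :=
  ((posDef_toeplitz_succ_iff_condD γ n).1
    (posDef_toeplitz_of_le (Nat.succ_le_succ hn) h)).2

theorem condC_zero (γ : ℕ → Matrix (Fin d) (Fin d) ℝ) : condC γ 0 = γ 0 := by
  ext a b
  simp [condC, Matrix.mul_apply]

/-- The block Levinson update of the forward dispersion matrix. -/
theorem condC_succ {γ : ℕ → Matrix (Fin d) (Fin d) ℝ} {n : ℕ}
    (h : (toeplitz γ (n + 1)).PosDef) :
    condC γ (n + 1) =
      condC γ n - partialCov γ n * (condD γ n)⁻¹ * (partialCov γ n)ᵀ := by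
  have hT := ((posDef_toeplitz_succ_iff_condC γ n).1 h).1
  have h' := (posDef_submatrix_equiv_iff (splitLast d n) _).2 h
  rw [toeplitz_submatrix_splitLast] at h'
  have hTt : ((toeplitz γ n)⁻¹)ᵀ = (toeplitz γ n)⁻¹ := by
    simpa [conjTranspose_eq_transpose_of_trivial] using hT.inv.isHermitian.eq
  have hW : (γ (n + 1))ᵀ - (kappa γ n)ᵀ * (toeplitz γ n)⁻¹ * xi γ n = (partialCov γ n)ᵀ := by
    simp [partialCov, predCov, transpose_sub, transpose_mul, hTt, Matrix.mul_assoc]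
  -- Reindexed so that the oldest observation comes last. Completing the square then adds one term
  -- to the quadratic form for `n` blocks: its residual is `W_{n+1}ᵀ` and its Schur complement is
  -- `D_n`.
  have e : (xi γ (n + 1))ᵀ * (toeplitz γ (n + 1))⁻¹ * xi γ (n + 1) =
      ((xi γ (n + 1)).submatrix (splitLast d n) id)ᵀ *
        ((toeplitz γ (n + 1)).submatrix (splitLast d n) (splitLast d n))⁻¹ *
        (xi γ (n + 1)).submatrix (splitLast d n) id := by
    rw [inv_submatrix_equiv, transpose_submatrix, submatrix_mul_equiv, submatrix_mul_equiv,
      submatrix_id_id]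
  rw [condC, e, xi_submatrix_splitLast, toeplitz_submatrix_splitLast,
    sub_transpose_fromRows_mul_inv_fromBlocks_mul _ _ _ _ h', hW, transpose_transpose]
  rfl

/-! ### Dependence on finitely many lags -/

section congr

variable {γ γ' : ℕ → Matrix (Fin d) (Fin d) ℝ} {n : ℕ}

theorem toeplitz_congr (h : ∀ k < n, γ k = γ' k) : toeplitz γ n = toeplitz γ' n := by
  ext a b
  have h1 := h (b.1 - a.1) (by have := b.1.2; omega)
  have h2 := h (a.1 - b.1) (by have := a.1.2; omega)
  simp [toeplitz, h1, h2]

theorem xi_congr (h : ∀ k ≤ n, γ k = γ' k) : xi γ n = xi γ' n := by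
  ext a b
  simp [xi, h (a.1 + 1) a.1.2]

theorem kappa_congr (h : ∀ k ≤ n, γ k = γ' k) : kappa γ n = kappa γ' n := by
  ext a b
  simp [kappa, h (n - a.1) (Nat.sub_le _ _)]

theorem condC_congr (h : ∀ k ≤ n, γ k = γ' k) : condC γ n = condC γ' n := by
  simp only [condC, toeplitz_congr fun k hk => h k hk.le, xi_congr h, h 0 (Nat.zero_le _)]

theorem condD_congr (h : ∀ k ≤ n, γ k = γ' k) : condD γ n = condD γ' n := by
  simp only [condD, toeplitz_congr fun k hk => h k hk.le, kappa_congr h, h 0 (Nat.zero_le _)]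

theorem predCov_congr (h : ∀ k ≤ n, γ k = γ' k) : predCov γ n = predCov γ' n := by
  simp only [predCov, toeplitz_congr fun k hk => h k hk.le, kappa_congr h, xi_congr h]

theorem partialCov_congr (h : ∀ k ≤ n + 1, γ k = γ' k) : partialCov γ n = partialCov γ' n := by
  rw [partialCov, partialCov, predCov_congr fun k hk => h k (Nat.le_succ_of_le hk),
    h (n + 1) le_rfl]

theorem yuleWalker_congr (h : ∀ k ≤ n, γ k = γ' k) : yuleWalker γ n = yuleWalker γ' n := by
  funext k
  simp only [yuleWalker, toeplitz_congr fun k hk => h k hk.le, xi_congr h]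

/-- Autocovariances are determined by the lag zero and the partial covariances. -/
theorem eq_of_partialCov_eq {p : ℕ} (h0 : γ 0 = γ' 0)
    (h : ∀ j < p, partialCov γ j = partialCov γ' j) : ∀ k ≤ p, γ k = γ' k := by
  intro k
  induction k using Nat.strong_induction_on with
  | _ k ih =>
    intro hk
    obtain _ | k := k
    · exact h0
    · have h1 := h k hk
      have h2 : predCov γ k = predCov γ' k :=
        predCov_congr fun i hi => ih i (by omega) (by omega)
      rw [partialCov, partialCov, h2] at h1
      exact sub_left_injective h1

end congr

/-! ### The autocovariance recursion -/

theorem recTable_eq_recAutocov (Ω : Matrix (Fin d) (Fin d) ℝ)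
    (W : ℕ → Matrix (Fin d) (Fin d) ℝ) {n h : ℕ} (hn : h ≤ n) :
    recTable Ω W n h = recAutocov Ω W h := by
  induction n, hn using Nat.le_induction with
  | base => rfl
  | succ n hn ih => rw [recTable, Function.update_of_ne (by omega), ih]

theorem partialCov_recAutocov (Ω : Matrix (Fin d) (Fin d) ℝ)
    (W : ℕ → Matrix (Fin d) (Fin d) ℝ) (n : ℕ) : partialCov (recAutocov Ω W) n = W n := by
  have h1 : recAutocov Ω W (n + 1) = W n + predCov (recTable Ω W n) n := by
    rw [recAutocov, recTable, Function.update_self]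
  rw [partialCov, h1, predCov_congr fun k hk => recTable_eq_recAutocov Ω W hk,
    add_sub_cancel_right]

theorem FactorParam.autocov_zero {p : ℕ} {r : Fin p → ℕ} (θ : FactorParam d p r) :
    θ.autocov 0 = θ.Ω⁻¹ := rfl

theorem FactorParam.partialCov_autocov {p : ℕ} {r : Fin p → ℕ} (θ : FactorParam d p r)
    (j : Fin p) : partialCov θ.autocov j = θ.U j * (θ.V j)ᵀ := by
  rw [FactorParam.autocov, partialCov_recAutocov, dif_pos j.2]

end VAR


/-! ### Ranks and normalized rank factorizations -/

namespace Matrix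

section rank

variable {m n l : Type*} [Fintype n]

theorem mulVec_injective_of_rank_eq_card {K : Type*} [Field K] {V : Matrix m n K}
    (h : V.rank = Fintype.card n) : Function.Injective V.mulVec := by
  have h1 := LinearMap.finrank_range_add_finrank_ker V.mulVecLin
  rw [Module.finrank_fintype_fun_eq_card, ← h, Matrix.rank, Nat.add_eq_left,
    Submodule.finrank_eq_zero, LinearMap.ker_eq_bot] at h1
  exact h1

theorem mul_left_cancel_of_mulVec_injective {K : Type*} [Field K] {U : Matrix m n K}
    (h : Function.Injective U.mulVec) {X Y : Matrix n l K} (hXY : U * X = U * Y) : X = Y :=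
  ext_col fun j => h congr(($hXY).col j)

theorem isUnit_transpose_mul_self_of_rank [Fintype m] [DecidableEq n] {V : Matrix m n ℝ}
    (h : V.rank = Fintype.card n) : IsUnit (Vᵀ * V) :=
  mulVec_injective_iff_isUnit.1
    (mulVec_injective_of_rank_eq_card ((rank_transpose_mul_self V).trans h))

/-- For `V` of full column rank, `V (Vᵀ V)⁻¹` is a right inverse of `Vᵀ`, so multiplying by `Vᵀ`
loses no rank. -/
theorem rank_mul_transpose_of_rank_right [Fintype m] [DecidableEq n] {U : Matrix l n ℝ} {V : Matrix m n ℝ}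
    (h : V.rank = Fintype.card n) : (U * Vᵀ).rank = U.rank := by
  refine le_antisymm (rank_mul_le_left _ _) ?_
  have hu := (isUnit_iff_isUnit_det _).1 (isUnit_transpose_mul_self_of_rank h)
  calc U.rank = (U * Vᵀ * (V * (Vᵀ * V)⁻¹)).rank := by
        rw [Matrix.mul_assoc, ← Matrix.mul_assoc Vᵀ, mul_nonsing_inv _ hu, Matrix.mul_one]
    _ ≤ (U * Vᵀ).rank := rank_mul_le_left _ _

/-- Rank factorization. -/
theorem exists_rank_factorization [DecidableEq n] {K : Type*} [Field K] (W : Matrix m n K)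
    {r : ℕ} (h : W.rank = r) :
    ∃ (U : Matrix m (Fin r) K) (V : Matrix n (Fin r) K), W = U * Vᵀ := by
  have e : LinearMap.range W.mulVecLin ≃ₗ[K] (Fin r → K) :=
    LinearEquiv.ofFinrankEq _ _ (by rw [Module.finrank_fin_fun]; exact h)
  refine ⟨LinearMap.toMatrix' ((LinearMap.range W.mulVecLin).subtype ∘ₗ e.symm.toLinearMap),
    (LinearMap.toMatrix' (e.toLinearMap ∘ₗ W.mulVecLin.rangeRestrict))ᵀ, ?_⟩
  rw [transpose_transpose, ← LinearMap.toMatrix'_comp]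
  refine (LinearMap.toMatrix'_toLin' W).symm.trans (congrArg _ ?_)
  ext x i
  simp

theorem PosDef.exists_isUnit_transpose_mul_self [DecidableEq n] {G : Matrix n n ℝ}
    (hG : G.PosDef) : ∃ B : Matrix n n ℝ, IsUnit B ∧ G = Bᵀ * B := by
  open scoped MatrixOrder in
  obtain ⟨B, hB⟩ := CStarAlgebra.nonneg_iff_eq_star_mul_self.mp hG.posSemidef.nonneg
  rw [star_eq_conjTranspose, conjTranspose_eq_transpose_of_trivial] at hB
  refine ⟨B, ?_, hB⟩
  have h := (isUnit_iff_isUnit_det _).1 hG.isUnit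
  rw [hB, det_mul] at h
  exact (isUnit_iff_isUnit_det _).2 (isUnit_of_mul_isUnit_right h)

/-- Writing `G = Bᵀ B` makes the product the Gram matrix of the rows of `W Bᵀ`, and a real Gram
matrix has the rank of its factor. -/
theorem rank_mul_posDef_mul_transpose [Fintype m] [DecidableEq n] (W : Matrix m n ℝ) {G : Matrix n n ℝ}
    (hG : G.PosDef) : (W * G * Wᵀ).rank = W.rank := by
  obtain ⟨B, hB, rfl⟩ := hG.exists_isUnit_transpose_mul_self
  have : W * (Bᵀ * B) * Wᵀ = (W * Bᵀ) * (W * Bᵀ)ᵀ := by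
    simp only [transpose_mul, transpose_transpose, Matrix.mul_assoc]
  rw [this, rank_self_mul_transpose, rank_mul_eq_left_of_isUnit_det]
  rw [det_transpose]
  exact (isUnit_iff_isUnit_det _).1 hB

/-- Resolvent identity: `C'⁻¹ - C⁻¹ = C'⁻¹ (C - C') C⁻¹`. -/
theorem rank_inv_sub_inv [DecidableEq n] {C C' : Matrix n n ℝ} (hC : IsUnit C)
    (hC' : IsUnit C') : (C'⁻¹ - C⁻¹).rank = (C - C').rank := by
  have h := (isUnit_iff_isUnit_det _).1 hC
  have h' := (isUnit_iff_isUnit_det _).1 hC'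
  have : C'⁻¹ - C⁻¹ = C'⁻¹ * (C - C') * C⁻¹ := by
    rw [Matrix.mul_sub, Matrix.sub_mul, Matrix.mul_assoc, mul_nonsing_inv _ h,
      nonsing_inv_mul _ h', Matrix.mul_one, Matrix.one_mul]
  rw [this, rank_mul_eq_left_of_isUnit_det _ _ (isUnit_nonsing_inv_det _ h),
    rank_mul_eq_right_of_isUnit_det _ _ (isUnit_nonsing_inv_det _ h')]

/-- Both matrices are Schur complements of the block matrix with diagonal blocks `C`, `1` and
off-diagonal block `U`, taken with respect to its two diagonal blocks. -/
theorem posDef_sub_mul_transpose_iff [Fintype m] [DecidableEq n] [DecidableEq m] {C : Matrix m m ℝ}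
    (hC : C.PosDef) (U : Matrix m n ℝ) :
    (C - U * Uᵀ).PosDef ↔ (1 - Uᵀ * C⁻¹ * U).PosDef := by
  have h1 := posDef_fromBlocks_iff C U 1
  have h2 := posDef_fromBlocks_iff 1 Uᵀ C
  have h3 : (fromBlocks C U Uᵀ 1).PosDef ↔ (fromBlocks 1 Uᵀ Uᵀᵀ C).PosDef := by
    rw [transpose_transpose, ← VAR.posDef_submatrix_equiv_iff (Equiv.sumComm m n)]
    rw [Equiv.sumComm_apply, fromBlocks_submatrix_sum_swap_sum_swap]
  have h4 : (1 : Matrix n n ℝ).PosDef := PosDef.one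
  rw [inv_one, transpose_transpose, Matrix.mul_one] at h2
  rw [transpose_transpose] at h3
  tauto

variable {r : ℕ}

/-- A rank factorization `W = U Vᵀ` normalized by `Vᵀ G V = 1`. -/
theorem exists_normalized_factorization [Fintype m] [DecidableEq n] {W : Matrix m n ℝ} {G : Matrix n n ℝ}
    (hG : G.PosDef) (hW : W.rank = r) :
    ∃ (U : Matrix m (Fin r) ℝ) (V : Matrix n (Fin r) ℝ), W = U * Vᵀ ∧ Vᵀ * G * V = 1 := by
  obtain ⟨U, V, h⟩ := exists_rank_factorization W hW
  have hV : V.rank = Fintype.card (Fin r) := by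
    refine le_antisymm (rank_le_card_width V) ?_
    calc Fintype.card (Fin r) = (U * Vᵀ).rank := 
        (Fintype.card_fin r).trans (hW.symm.trans (congrArg _ h))
      _ ≤ Vᵀ.rank := rank_mul_le_right _ _
      _ = V.rank := rank_transpose V
  have hVG : (Vᵀ * G * V).PosDef := by
    simpa [conjTranspose_eq_transpose_of_trivial] using
      hG.conjTranspose_mul_mul_same (mulVec_injective_of_rank_eq_card hV)
  obtain ⟨B, hB, hBG⟩ := hVG.exists_isUnit_transpose_mul_self
  have hBd := (isUnit_iff_isUnit_det _).1 hB
  have hBt : IsUnit Bᵀ.det := by rwa [det_transpose]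
  -- Since `Vᵀ G V = Bᵀ B`, the change of basis `B⁻¹` orthonormalizes the columns of `V` for the
  -- form `G`; `Bᵀ` on `U` compensates.
  refine ⟨U * Bᵀ, V * B⁻¹, ?_, ?_⟩
  · rw [transpose_mul, transpose_nonsing_inv, Matrix.mul_assoc, ← Matrix.mul_assoc Bᵀ,
      mul_nonsing_inv _ hBt, Matrix.one_mul, h]
  · have : (V * B⁻¹)ᵀ * G * (V * B⁻¹) = (B⁻¹)ᵀ * (Vᵀ * G * V) * B⁻¹ := by
      simp only [transpose_mul, Matrix.mul_assoc]
    rw [this, hBG, transpose_nonsing_inv, ← Matrix.mul_assoc, nonsing_inv_mul _ hBt,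
      Matrix.one_mul, mul_nonsing_inv _ hBd]

theorem rank_left_of_factorization {U : Matrix m (Fin r) ℝ} {V : Matrix n (Fin r) ℝ}
    (h : (U * Vᵀ).rank = r) : U.rank = r := by
  refine le_antisymm ((rank_le_card_width U).trans_eq (Fintype.card_fin r)) ?_
  exact h.symm.trans_le (rank_mul_le_left _ _)

theorem rank_right_of_factorization {U : Matrix m (Fin r) ℝ} {V : Matrix n (Fin r) ℝ}
    (h : (U * Vᵀ).rank = r) : V.rank = r := by
  refine le_antisymm ((rank_le_card_width V).trans_eq (Fintype.card_fin r)) ?_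
  exact h.symm.trans_le ((rank_mul_le_right _ _).trans_eq (rank_transpose V))

/-- Normalized rank factorizations are unique up to rotation. -/
theorem normalized_factorization_iff [Fintype m] {G : Matrix n n ℝ} (hGt : Gᵀ = G)
    {U U' : Matrix m (Fin r) ℝ} {V V' : Matrix n (Fin r) ℝ}
    (hU : U.rank = r) (hV : Vᵀ * G * V = 1) :
    (U * Vᵀ = U' * V'ᵀ ∧ V'ᵀ * G * V' = 1) ↔
      ∃ Q ∈ orthogonalGroup (Fin r) ℝ, U' = U * Q ∧ V' = V * Q := by
  constructor
  · rintro ⟨h, hV'⟩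
    have hinj := mulVec_injective_of_rank_eq_card (hU.trans (Fintype.card_fin r).symm)
    have hU' : U' = U * (Vᵀ * G * V') := by
      simp only [← Matrix.mul_assoc]
      rw [h, Matrix.mul_assoc, Matrix.mul_assoc, ← Matrix.mul_assoc V'ᵀ, hV', Matrix.mul_one]
    have hU2 : U = U' * (Vᵀ * G * V')ᵀ := by
      have : (Vᵀ * G * V')ᵀ = V'ᵀ * G * V := by
        simp only [transpose_mul, hGt, transpose_transpose, Matrix.mul_assoc]
      rw [this]
      simp only [← Matrix.mul_assoc]
      rw [← h, Matrix.mul_assoc, Matrix.mul_assoc, ← Matrix.mul_assoc Vᵀ, hV, Matrix.mul_one]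
    -- This `Q` is forced: multiply `U Vᵀ = U' V'ᵀ` on the right by `G V'`. Multiplying by `G V`
    -- instead gives `U = U' Qᵀ`, and cancelling the injective `U` gives `Q Qᵀ = 1`.
    set Q := Vᵀ * G * V' with hQ
    have hQQ : Q * Qᵀ = 1 := by
      refine mul_left_cancel_of_mulVec_injective hinj ?_
      rw [← Matrix.mul_assoc, ← hU', ← hU2, Matrix.mul_one]
    have hQQ' : Qᵀ * Q = 1 := mul_eq_one_comm.1 hQQ
    refine ⟨Q, (mem_orthogonalGroup_iff _ _).2 hQQ, hU', ?_⟩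
    have hVt : Vᵀ = Q * V'ᵀ := by
      refine mul_left_cancel_of_mulVec_injective hinj ?_
      rw [h, ← Matrix.mul_assoc, ← hU']
    have hV2 : V = V' * Qᵀ := by
      rw [← transpose_transpose V, hVt, transpose_mul, transpose_transpose]
    rw [hV2, Matrix.mul_assoc, hQQ', Matrix.mul_one]
  · rintro ⟨Q, hQ, rfl, rfl⟩
    have hQ1 := (mem_orthogonalGroup_iff _ _).1 hQ
    have hQ2 := (mem_orthogonalGroup_iff' _ _).1 hQ
    constructor
    · rw [transpose_mul, Matrix.mul_assoc, ← Matrix.mul_assoc Q, hQ1, Matrix.one_mul]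
    · have : (V * Q)ᵀ * G * (V * Q) = Qᵀ * (Vᵀ * G * V) * Q := by
        simp only [transpose_mul, Matrix.mul_assoc]
      rw [this, hV, Matrix.mul_one, hQ2]

end rank

end Matrix


namespace VAR

open Matrix Filter Topology

variable {d p : ℕ}

/-! ### Companion matrices -/

section companion

variable {K : Type*} [CommRing K]

/-- The block companion matrix of the state `(X_t, …, X_{t-p})`. -/
def companion (A : Fin p → Matrix (Fin d) (Fin d) K) :
    Matrix (Fin (p + 1) × Fin d) (Fin (p + 1) × Fin d) K :=
  of fun a b => Fin.cases (motive := fun _ => K)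
    (Fin.lastCases (motive := fun _ => K) 0 (fun k => A k a.2 b.2) b.1)
    (fun i => if (i.castSucc, a.2) = b then 1 else 0) a.1

variable (A : Fin p → Matrix (Fin d) (Fin d) K)

@[simp] theorem companion_zero_castSucc (k : Fin p) (a b : Fin d) :
    companion A (0, a) (k.castSucc, b) = A k a b := by simp [companion]

@[simp] theorem companion_zero_last (a b : Fin d) :
    companion A (0, a) (Fin.last p, b) = 0 := by simp [companion]

@[simp] theorem companion_succ (i : Fin p) (a : Fin d) (b : Fin (p + 1) × Fin d) :
    companion A (i.succ, a) b = if (i.castSucc, a) = b then 1 else 0 := by simp [companion]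

theorem companion_mulVec_zero (v : Fin (p + 1) × Fin d → K) (a : Fin d) :
    (companion A *ᵥ v) (0, a) = ∑ k : Fin p, ∑ b, A k a b * v (k.castSucc, b) := by
  simp [mulVec, dotProduct, Fintype.sum_prod_type, Fin.sum_univ_castSucc]

theorem companion_mulVec_succ (v : Fin (p + 1) × Fin d → K) (i : Fin p) (a : Fin d) :
    (companion A *ᵥ v) (i.succ, a) = v (i.castSucc, a) := by
  simp [mulVec, dotProduct]

theorem vecMul_companion_castSucc (w : Fin (p + 1) × Fin d → K) (j : Fin p) (b : Fin d) :
    (w ᵥ* companion A) (j.castSucc, b) = ∑ a, w (0, a) * A j a b + w (j.succ, b) := by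
  simp [vecMul, dotProduct, Fintype.sum_prod_type, Fin.sum_univ_succ, Prod.ext_iff, ite_and]

theorem companion_map {L : Type*} [CommRing L] (f : K →+* L) :
    (companion A).map f = companion fun k => (A k).map f := by
  ext ⟨i, a⟩ ⟨j, b⟩
  induction i using Fin.cases with
  | zero =>
    induction j using Fin.lastCases <;> simp
  | succ i => simp [apply_ite f]

end companion

/-- All roots of `det (1 - A_1 z - ⋯ - A_p z^p)` lie outside the closed unit disc. -/
def IsCausalPoly (A : Fin p → Matrix (Fin d) (Fin d) ℝ) : Prop :=
  ∀ z : ℂ, ‖z‖ ≤ 1 →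
    (1 - ∑ k : Fin p, z ^ ((k : ℕ) + 1) • (A k).map ((↑) : ℝ → ℂ)).det ≠ 0

/-! ### Causality implies that powers of the companion matrix are summable -/

section stability

attribute [local instance] Matrix.linftyOpNormedRing Matrix.linftyOpNormedAlgebra

/-- In a complex Banach algebra, the powers of an element of spectral radius less than one
are summable in norm. -/
theorem summable_norm_pow_of_spectralRadius_lt_one {𝒜 : Type*} [NormedRing 𝒜]
    [NormedAlgebra ℂ 𝒜] [CompleteSpace 𝒜] {a : 𝒜} (h : spectralRadius ℂ a < 1) :
    Summable fun n : ℕ => ‖a ^ n‖ := by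
  obtain ⟨ρ, hρ1, hρ2⟩ := ENNReal.lt_iff_exists_nnreal_btwn.1 h
  -- Gelfand's formula: `‖aⁿ‖^(1/n)` is eventually below some `ρ < 1`, so the geometric series
  -- dominates.
  have h1 := (spectrum.pow_nnnorm_pow_one_div_tendsto_nhds_spectralRadius a).eventually_lt_const
    hρ1
  have hρ : (ρ : ℝ) < 1 := by exact_mod_cast hρ2
  refine Summable.of_norm_bounded_eventually_nat (summable_geometric_of_lt_one ρ.2 hρ) ?_
  filter_upwards [h1, eventually_gt_atTop 0] with n hn hn0
  have h2 : (‖a ^ n‖₊ : ENNReal) ≤ (ρ : ENNReal) ^ n := by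
    rw [one_div] at hn
    have := ENNReal.rpow_le_rpow hn.le (Nat.cast_nonneg n)
    rwa [ENNReal.rpow_inv_rpow (by exact_mod_cast hn0.ne'), ENNReal.rpow_natCast] at this
  rw [norm_norm]
  exact_mod_cast h2

/-- The shift rows force an eigenvector for `z ≠ 0` to have blocks `z⁻ⁱ v₀`; the first block row
then says that `v₀` is in the kernel of the autoregressive polynomial at `z⁻¹`. If `|z| ≥ 1`,
causality excludes this. -/
theorem norm_lt_one_of_mem_spectrum_companion {A : Fin p → Matrix (Fin d) (Fin d) ℂ}
    (hA : ∀ z : ℂ, ‖z‖ ≤ 1 → (1 - ∑ k : Fin p, z ^ ((k : ℕ) + 1) • A k).det ≠ 0)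
    {z : ℂ} (hz : z ∈ spectrum ℂ (companion A)) : ‖z‖ < 1 := by
  by_contra! hz1
  have hz0 : z ≠ 0 := by
    rintro rfl
    simp at hz1
    linarith
  rw [spectrum.mem_iff, isUnit_iff_isUnit_det, isUnit_iff_ne_zero, not_not] at hz
  obtain ⟨v, hv0, hv⟩ := exists_mulVec_eq_zero_iff.2 hz
  rw [sub_mulVec, sub_eq_zero, Algebra.algebraMap_eq_smul_one, smul_mulVec, one_mulVec] at hv
  have hpow : ∀ i : Fin (p + 1), ∀ a, v (i, a) = z⁻¹ ^ (i : ℕ) * v (0, a) := by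
    intro i
    induction i using Fin.induction with
    | zero => simp
    | succ i ih =>
      intro a
      have h1 := congrFun hv (i.succ, a)
      rw [companion_mulVec_succ, ih, Pi.smul_apply, smul_eq_mul] at h1
      rw [Fin.val_succ, pow_succ', mul_assoc, ← Fin.val_castSucc i, ← h1, inv_mul_cancel_left₀ hz0]
  refine hA z⁻¹ (by rw [norm_inv]; exact inv_le_one_of_one_le₀ hz1) ?_
  refine exists_mulVec_eq_zero_iff.1 ⟨fun a => v (0, a), ?_, ?_⟩
  · intro h0
    refine hv0 (funext fun ⟨i, a⟩ => ?_)
    rw [hpow, congrFun h0 a]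
    simp
  · ext a
    have h1 := congrFun hv (0, a)
    rw [companion_mulVec_zero, Pi.smul_apply, smul_eq_mul] at h1
    rw [sub_mulVec, one_mulVec, Pi.sub_apply, Pi.zero_apply, sub_eq_zero, sum_mulVec,
      Finset.sum_apply]
    calc v (0, a) = z⁻¹ * ∑ k : Fin p, ∑ b, A k a b * v (k.castSucc, b) := by
          rw [← h1, inv_mul_cancel_left₀ hz0]
      _ = _ := by
          rw [Finset.mul_sum]
          refine Finset.sum_congr rfl fun k _ => ?_
          rw [smul_mulVec, Pi.smul_apply, mulVec, dotProduct, Finset.smul_sum, Finset.mul_sum]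
          refine Finset.sum_congr rfl fun b _ => ?_
          rw [hpow, smul_eq_mul, pow_succ, Fin.val_castSucc]
          ring

theorem summable_companion_pow {A : Fin p → Matrix (Fin d) (Fin d) ℝ} (hA : IsCausalPoly A)
    (x y : Fin (p + 1) × Fin d) : Summable fun n : ℕ => |(companion A ^ n) x y| := by
  set B : Fin p → Matrix (Fin d) (Fin d) ℂ := fun k => (A k).map Complex.ofRealHom
  have hB : (companion A).map Complex.ofRealHom = companion B := companion_map A _
  have hr : spectralRadius ℂ (companion B) < 1 := by
    -- The empty case is `d = 0`; otherwise the supremum over the spectrum is attained, which keeps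
    -- the inequality strict.
    rcases (spectrum ℂ (companion B)).eq_empty_or_nonempty with h | h
    · simp [spectralRadius, h]
    · refine (spectrum.spectralRadius_lt_of_forall_lt_of_nonempty h (r := 1)
        fun z hz => ?_).trans_eq ENNReal.coe_one
      exact norm_lt_one_of_mem_spectrum_companion (A := B) hA hz
  refine (summable_norm_pow_of_spectralRadius_lt_one hr).of_nonneg_of_le
    (fun n => abs_nonneg _) fun n => ?_
  have h1 : (companion B ^ n) x y = ((companion A ^ n) x y : ℂ) := by
    rw [← hB, ← RingHom.mapMatrix_apply, ← map_pow]
    rfl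
  calc |(companion A ^ n) x y| = ‖(companion B ^ n) x y‖ := by
        rw [h1, Complex.norm_real, Real.norm_eq_abs]
    _ ≤ ∑ j, ‖(companion B ^ n) x j‖ :=
        Finset.single_le_sum (f := fun j => ‖(companion B ^ n) x j‖)
          (fun _ _ => norm_nonneg _) (Finset.mem_univ y)
    _ ≤ ‖companion B ^ n‖ := by
        rw [linfty_opNorm_def]
        have := Finset.le_sup (f := fun i => ∑ j, ‖(companion B ^ n) i j‖₊) (Finset.mem_univ x)
        refine le_trans (le_of_eq ?_) (NNReal.coe_le_coe.2 this)
        push_cast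
        rfl

end stability

theorem tendsto_companion_pow {A : Fin p → Matrix (Fin d) (Fin d) ℝ} (hA : IsCausalPoly A) :
    Tendsto (fun n : ℕ => companion A ^ n) atTop (𝓝 0) :=
  tendsto_pi_nhds.2 fun x => tendsto_pi_nhds.2 fun y =>
    tendsto_zero_iff_abs_tendsto_zero _ |>.2 (summable_companion_pow hA x y).tendsto_atTop_zero

/-! ### The discrete Lyapunov equation -/

/-- The embedding of the first block. -/
def firstBlock (d p : ℕ) : Matrix (Fin (p + 1) × Fin d) (Fin d) ℝ :=
  of fun a b => if a = (0, b) then 1 else 0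

/-- The discrete Lyapunov equation of the state covariance matrix `T`. -/
def IsLyapunov (A : Fin p → Matrix (Fin d) (Fin d) ℝ) (S : Matrix (Fin d) (Fin d) ℝ)
    (T : Matrix (Fin (p + 1) × Fin d) (Fin (p + 1) × Fin d) ℝ) : Prop :=
  T = companion A * T * (companion A)ᵀ + firstBlock d p * S * (firstBlock d p)ᵀ

section lyapunov

variable {A : Fin p → Matrix (Fin d) (Fin d) ℝ} {S : Matrix (Fin d) (Fin d) ℝ}
  {T T' : Matrix (Fin (p + 1) × Fin d) (Fin (p + 1) × Fin d) ℝ}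

theorem vecMul_firstBlock (w : Fin (p + 1) × Fin d → ℝ) :
    w ᵥ* firstBlock d p = fun a => w (0, a) := by
  ext b
  simp [vecMul, dotProduct, firstBlock]

theorem IsLyapunov.dotProduct_mulVec (h : IsLyapunov A S T) (w : Fin (p + 1) × Fin d → ℝ) :
    w ⬝ᵥ T *ᵥ w = (w ᵥ* companion A) ⬝ᵥ T *ᵥ (w ᵥ* companion A) +
      (fun a => w (0, a)) ⬝ᵥ S *ᵥ (fun a => w (0, a)) := by
  conv_lhs => rw [h]
  rw [add_mulVec, dotProduct_add, ← mulVec_mulVec, ← mulVec_mulVec, ← mulVec_mulVec,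
    ← mulVec_mulVec, Matrix.dotProduct_mulVec, Matrix.dotProduct_mulVec w (firstBlock d p),
    mulVec_transpose, mulVec_transpose, vecMul_firstBlock]

/-- The noise term cancels in the difference `Δ` of two solutions, so `Δ = Fⁿ Δ (Fⁿ)ᵀ` for all `n`,
and the right side tends to zero. -/
theorem IsLyapunov.unique (hA : IsCausalPoly A) (h : IsLyapunov A S T)
    (h' : IsLyapunov A S T') : T = T' := by
  have h1 : T - T' = companion A * (T - T') * (companion A)ᵀ := by
    conv_lhs => rw [h, h']
    rw [Matrix.mul_sub, Matrix.sub_mul, add_sub_add_right_eq_sub]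
  have h2 : ∀ n : ℕ, T - T' = companion A ^ n * (T - T') * (companion A ^ n)ᵀ := by
    intro n
    induction n with
    | zero => simp
    | succ n ih =>
      conv_lhs => rw [ih, h1]
      simp only [pow_succ, transpose_mul, Matrix.mul_assoc]
  have hc : Continuous fun M : Matrix (Fin (p + 1) × Fin d) (Fin (p + 1) × Fin d) ℝ =>
      M * (T - T') * Mᵀ := by fun_prop
  have h3 := (hc.tendsto 0).comp (tendsto_companion_pow hA)
  have h4 : Tendsto (fun _ : ℕ => T - T') atTop
      (𝓝 ((0 : Matrix (Fin (p + 1) × Fin d) (Fin (p + 1) × Fin d) ℝ) * (T - T') * 0ᵀ)) :=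
    h3.congr fun n => (h2 n).symm
  have h5 := tendsto_nhds_unique tendsto_const_nhds h4
  rw [transpose_zero, Matrix.mul_zero] at h5
  exact sub_eq_zero.1 h5

/-- Along `w_n = v Fⁿ` the form `q n` of `T` decreases, by the value of `S` at the first block of
`w_n`, and tends to zero; hence it is nonnegative. If `q 0 = 0`, every first block vanishes, and the
shift structure of `F` carries this to all blocks of `v`. -/
theorem IsLyapunov.posDef (hA : IsCausalPoly A) (hS : S.PosDef) (hT : Tᵀ = T)
    (h : IsLyapunov A S T) : T.PosDef := by
  refine PosDef.of_dotProduct_mulVec_pos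
    (by rw [IsHermitian, conjTranspose_eq_transpose_of_trivial, hT]) fun v hv => ?_
  rw [star_trivial]
  set w : ℕ → Fin (p + 1) × Fin d → ℝ := fun n => v ᵥ* companion A ^ n with hw
  have hw1 : ∀ n, w n ᵥ* companion A = w (n + 1) := fun n => by
    simp only [hw, vecMul_vecMul, pow_succ]
  set q : ℕ → ℝ := fun n => w n ⬝ᵥ T *ᵥ w n with hq
  have hq0 : q 0 = v ⬝ᵥ T *ᵥ v := by simp [hq, hw]
  have hs : ∀ n, 0 ≤ (fun a => w n (0, a)) ⬝ᵥ S *ᵥ (fun a => w n (0, a)) := fun n => by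
    simpa using hS.posSemidef.dotProduct_mulVec_nonneg fun a => w n (0, a)
  have hqs : ∀ n, q n = q (n + 1) + (fun a => w n (0, a)) ⬝ᵥ S *ᵥ (fun a => w n (0, a)) :=
    fun n => by
      have := h.dotProduct_mulVec (w n)
      rwa [hw1] at this
  have hanti : Antitone q := antitone_nat_of_succ_le fun n => by linarith [hqs n, hs n]
  have hlim : Tendsto q atTop (𝓝 0) := by
    have hc : Continuous fun M : Matrix (Fin (p + 1) × Fin d) (Fin (p + 1) × Fin d) ℝ =>
        (v ᵥ* M) ⬝ᵥ T *ᵥ (v ᵥ* M) := by fun_prop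
    have h0 := (hc.tendsto 0).comp (tendsto_companion_pow hA)
    simp only [vecMul_zero, zero_dotProduct] at h0
    exact h0
  have hnn : ∀ n, 0 ≤ q n := fun n => hanti.le_of_tendsto hlim n
  rw [← hq0]
  refine (hnn 0).lt_of_ne fun h0 => hv ?_
  have hqz : ∀ n, q n = 0 := fun n => le_antisymm ((hanti n.zero_le).trans_eq h0.symm) (hnn n)
  have hz0 : ∀ n a, w n (0, a) = 0 := by
    intro n a
    by_contra hne
    have := hS.dotProduct_mulVec_pos (x := fun a => w n (0, a)) fun h => hne (congrFun h a)
    rw [star_trivial] at this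
    linarith [hqs n, hqz n, hqz (n + 1)]
  -- When first blocks vanish, block `i + 1` of `w n` is block `i` of `w (n + 1)`. This is why the
  -- induction is uniform in `n`.
  have hz : ∀ i : Fin (p + 1), ∀ n a, w n (i, a) = 0 := by
    intro i
    induction i using Fin.induction with
    | zero => exact hz0
    | succ i ih =>
      intro n a
      have h1 := ih (n + 1) a
      rw [← hw1, vecMul_companion_castSucc] at h1
      simpa [hz0] using h1
  ext ⟨i, a⟩
  simpa [hw] using hz i 0 a

/-- A root `z` with `|z| ≤ 1` gives a left eigenvector `w` of `F` with eigenvalue `l = z⁻¹`, `|l| ≥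
1`. Evaluating the Lyapunov equation at `w` gives `(|l|² - 1) w T w* + w₀ S w₀* = 0`, so `w₀ = 0`,
and the shift structure then kills `w`. -/
theorem IsLyapunov.isCausalPoly (hT : T.PosDef) (hS : S.PosDef) (h : IsLyapunov A S T) :
    IsCausalPoly A := by
  intro z hz hdet
  obtain ⟨u, hu0, hu⟩ := exists_mulVec_eq_zero_iff.2 hdet
  have hz0 : z ≠ 0 := by
    rintro rfl
    simp at hu
    exact hu0 hu
  set B : Fin p → Matrix (Fin d) (Fin d) ℂ := fun k => (A k).map Complex.ofRealHom with hBdef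
  have hB : (companion A).map Complex.ofRealHom = companion B := companion_map A _
  -- The explicit right eigenvector `(u, z u, z² u, …)` only serves to show that the determinant
  -- vanishes; a left eigenvector then exists.
  obtain ⟨w, hw0, hw⟩ : ∃ w, w ≠ 0 ∧ w ᵥ* companion B = z⁻¹ • w := by
    have hdet' : (z⁻¹ • (1 : Matrix (Fin (p + 1) × Fin d) (Fin (p + 1) × Fin d) ℂ)
        - companion B).det = 0 := by
      refine exists_mulVec_eq_zero_iff.1 ⟨fun x => z ^ (x.1 : ℕ) * u x.2, ?_, ?_⟩
      · intro h0
        refine hu0 (funext fun a => ?_)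
        simpa using congrFun h0 (0, a)
      · rw [sub_mulVec, sub_eq_zero, smul_mulVec, one_mulVec]
        ext ⟨i, a⟩
        rw [Pi.smul_apply, smul_eq_mul]
        induction i using Fin.cases with
        | zero =>
          have h1 := congrFun hu a
          rw [sub_mulVec, one_mulVec, Pi.sub_apply, Pi.zero_apply, sub_eq_zero, sum_mulVec,
            Finset.sum_apply] at h1
          rw [companion_mulVec_zero, inv_mul_eq_iff_eq_mul₀ hz0, Fin.val_zero, pow_zero, one_mul,
            h1, Finset.mul_sum]
          refine Finset.sum_congr rfl fun k _ => ?_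
          rw [smul_mulVec, Pi.smul_apply, mulVec, dotProduct, Finset.smul_sum, Finset.mul_sum]
          refine Finset.sum_congr rfl fun b _ => ?_
          simp only [hBdef, map_apply, Complex.ofRealHom_eq_coe, smul_eq_mul, Fin.val_castSucc,
            pow_succ]
          ring
        | succ i =>
          rw [companion_mulVec_succ, Fin.val_succ, Fin.val_castSucc, pow_succ']
          field_simp
    obtain ⟨w, hw0, hw⟩ := exists_vecMul_eq_zero_iff.2 hdet'
    refine ⟨w, hw0, ?_⟩
    rw [vecMul_sub, sub_eq_zero, vecMul_smul, vecMul_one] at hw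
    exact hw.symm
  obtain ⟨l, hl⟩ : ∃ l, l = z⁻¹ := ⟨_, rfl⟩
  rw [← hl] at hw
  set α := l.re with hα
  set β := l.im with hβ
  set x : Fin (p + 1) × Fin d → ℝ := fun i => (w i).re with hx
  set y : Fin (p + 1) × Fin d → ℝ := fun i => (w i).im with hy
  -- Real and imaginary parts of the eigenvector equation, so that only real quadratic forms are
  -- needed; the cross terms cancel in the sum.
  have hxF : x ᵥ* companion A = α • x - β • y := by
    ext j
    have h1 := congrArg Complex.re (congrFun hw j)
    rw [← hB] at h1
    simpa [vecMul, dotProduct, Complex.mul_re, hx, hy, hα, hβ] using h1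
  have hyF : y ᵥ* companion A = β • x + α • y := by
    ext j
    have h1 := congrArg Complex.im (congrFun hw j)
    rw [← hB] at h1
    simpa [vecMul, dotProduct, Complex.mul_im, hx, hy, hα, hβ, add_comm] using h1
  have hab : 1 ≤ α ^ 2 + β ^ 2 := by
    have h1 : α ^ 2 + β ^ 2 = ‖l‖ ^ 2 := by
      rw [← Complex.normSq_eq_norm_sq, Complex.normSq_apply]
      ring
    rw [h1, hl, norm_inv]
    exact one_le_pow₀ ((one_le_inv₀ (norm_pos_iff.2 hz0)).2 hz)
  have hx1 := h.dotProduct_mulVec x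
  have hy1 := h.dotProduct_mulVec y
  rw [hxF] at hx1
  rw [hyF] at hy1
  simp only [mulVec_sub, mulVec_add, mulVec_smul, dotProduct_sub, dotProduct_add, dotProduct_smul,
    sub_dotProduct, add_dotProduct, smul_dotProduct, smul_eq_mul] at hx1 hy1
  have hTnn : ∀ v, 0 ≤ v ⬝ᵥ T *ᵥ v := fun v => by
    simpa using hT.posSemidef.dotProduct_mulVec_nonneg v
  have hSnn : ∀ v, 0 ≤ v ⬝ᵥ S *ᵥ v := fun v => by
    simpa using hS.posSemidef.dotProduct_mulVec_nonneg v
  have hsum : (fun a => x (0, a)) ⬝ᵥ S *ᵥ (fun a => x (0, a)) +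
      (fun a => y (0, a)) ⬝ᵥ S *ᵥ (fun a => y (0, a)) ≤ 0 := by
    have h1 : (x ⬝ᵥ T *ᵥ x + y ⬝ᵥ T *ᵥ y) * (α ^ 2 + β ^ 2 - 1) +
      ((fun a => x (0, a)) ⬝ᵥ S *ᵥ (fun a => x (0, a)) +
      (fun a => y (0, a)) ⬝ᵥ S *ᵥ (fun a => y (0, a))) = 0 := by linear_combination -hx1 - hy1
    have h2 := mul_nonneg (add_nonneg (hTnn x) (hTnn y)) (sub_nonneg.2 hab)
    linarith
  have hSz : ∀ v, v ⬝ᵥ S *ᵥ v ≤ 0 → v = 0 := fun v hv => by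
    by_contra hne
    have := hS.dotProduct_mulVec_pos hne
    rw [star_trivial] at this
    linarith
  have hx0 := hSz _ (by linarith [hSnn fun a => y (0, a)] :
    (fun a => x (0, a)) ⬝ᵥ S *ᵥ (fun a => x (0, a)) ≤ 0)
  have hy0 := hSz _ (by linarith [hSnn fun a => x (0, a)] :
    (fun a => y (0, a)) ⬝ᵥ S *ᵥ (fun a => y (0, a)) ≤ 0)
  have hw00 : ∀ a, w (0, a) = 0 := fun a =>
    Complex.ext (congrFun hx0 a) (congrFun hy0 a)
  refine hw0 (funext fun ⟨i, a⟩ => ?_)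
  induction i using Fin.induction generalizing a with
  | zero => exact hw00 a
  | succ i ih =>
    have h1 := congrFun hw (i.castSucc, a)
    rw [vecMul_companion_castSucc, Pi.smul_apply, ih] at h1
    simpa [hw00] using h1

end lyapunov

end VAR


namespace VAR

open Matrix Filter Topology

variable {d p : ℕ}

/-! ### Yule-Walker equations -/

/-- The row `(A_1, …, A_p)`. -/
def coeffRow (A : Fin p → Matrix (Fin d) (Fin d) ℝ) : Matrix (Fin d) (Fin p × Fin d) ℝ :=
  of fun a b => A b.1 a b.2

theorem coeffRow_mul_apply (A : Fin p → Matrix (Fin d) (Fin d) ℝ) {l : Type*}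
    (M : Matrix (Fin p × Fin d) l ℝ) (a : Fin d) (x : l) :
    (coeffRow A * M) a x = ∑ k, ∑ b, A k a b * M (k, b) x := by
  simp [Matrix.mul_apply, coeffRow, Fintype.sum_prod_type]

theorem coeffRow_yuleWalker (γ : ℕ → Matrix (Fin d) (Fin d) ℝ) :
    coeffRow (yuleWalker γ p) = (xi γ p)ᵀ * (toeplitz γ p)⁻¹ := rfl

theorem coeffRow_injective :
    Function.Injective (coeffRow : (Fin p → Matrix (Fin d) (Fin d) ℝ) → _) := by
  intro A B h
  funext k
  ext a b
  exact congrFun (congrFun h a) (k, b)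

/-- The Yule-Walker equations. -/
structure IsYuleWalker (A : Fin p → Matrix (Fin d) (Fin d) ℝ) (S : Matrix (Fin d) (Fin d) ℝ)
    (γ : ℕ → Matrix (Fin d) (Fin d) ℝ) : Prop where
  symm_zero : (γ 0)ᵀ = γ 0
  coeff : (xi γ p)ᵀ = coeffRow A * toeplitz γ p
  innov : γ 0 = coeffRow A * xi γ p + S

theorem transpose_toeplitz {γ : ℕ → Matrix (Fin d) (Fin d) ℝ} (h : (γ 0)ᵀ = γ 0) (n : ℕ) :
    (toeplitz γ n)ᵀ = toeplitz γ n := by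
  ext ⟨i, a⟩ ⟨k, b⟩
  rw [transpose_apply]
  simp only [toeplitz, of_apply]
  rcases lt_trichotomy i k with hik | rfl | hik
  · rw [if_neg hik.not_ge, if_pos hik.le]
  · simpa using congrFun (congrFun h a) b
  · rw [if_pos hik.le, if_neg hik.not_ge]

theorem isYuleWalker_yuleWalker {γ : ℕ → Matrix (Fin d) (Fin d) ℝ}
    (h : (toeplitz γ (p + 1)).PosDef) : IsYuleWalker (yuleWalker γ p) (condC γ p) γ where
  symm_zero := by
    have := (condC_posDef (Nat.zero_le p) h).isHermitian.eq
    rwa [condC_zero, conjTranspose_eq_transpose_of_trivial] at this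
  coeff := by
    have hu := (isUnit_iff_isUnit_det _).1 (posDef_toeplitz_of_le p.le_succ h).isUnit
    rw [coeffRow_yuleWalker, Matrix.mul_assoc, nonsing_inv_mul _ hu, Matrix.mul_one]
  innov := by
    rw [coeffRow_yuleWalker, condC, add_sub_cancel]

theorem IsYuleWalker.eq_yuleWalker {A : Fin p → Matrix (Fin d) (Fin d) ℝ}
    {S : Matrix (Fin d) (Fin d) ℝ} {γ : ℕ → Matrix (Fin d) (Fin d) ℝ} (h : IsYuleWalker A S γ)
    (hγ : (toeplitz γ p).PosDef) : A = yuleWalker γ p ∧ S = condC γ p := by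
  have hu := (isUnit_iff_isUnit_det _).1 hγ.isUnit
  have hA : coeffRow A = (xi γ p)ᵀ * (toeplitz γ p)⁻¹ := by
    rw [h.coeff, Matrix.mul_assoc, mul_nonsing_inv _ hu, Matrix.mul_one]
  refine ⟨coeffRow_injective hA, ?_⟩
  rw [condC, ← hA]
  exact eq_sub_of_add_eq' h.innov.symm

theorem toeplitz_castSucc (γ : ℕ → Matrix (Fin d) (Fin d) ℝ) (n : ℕ) (i k : Fin n)
    (a b : Fin d) :
    toeplitz γ (n + 1) (i.castSucc, a) (k.castSucc, b) = toeplitz γ n (i, a) (k, b) := by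
  simp [toeplitz]

theorem toeplitz_succ (γ : ℕ → Matrix (Fin d) (Fin d) ℝ) (n : ℕ) (i k : Fin n)
    (a b : Fin d) :
    toeplitz γ (n + 1) (i.succ, a) (k.succ, b) = toeplitz γ n (i, a) (k, b) := by
  simp [toeplitz]

/-- The first block row and column are the Yule-Walker equations; every other block says that `T` is
constant along block diagonals. The `p + 1` blocks of the state make `T` contain all lags up to `p`.
-/
theorem IsYuleWalker.isLyapunov {A : Fin p → Matrix (Fin d) (Fin d) ℝ}
    {S : Matrix (Fin d) (Fin d) ℝ} {γ : ℕ → Matrix (Fin d) (Fin d) ℝ} (hS : Sᵀ = S)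
    (h : IsYuleWalker A S γ) : IsLyapunov A S (toeplitz γ (p + 1)) := by
  set T := toeplitz γ (p + 1) with hT
  have hTt : Tᵀ = T := transpose_toeplitz h.symm_zero _
  have hTt' : ∀ x y, T x y = T y x := fun x y => congrFun (congrFun hTt y) x
  have hG0 : ∀ (M : Matrix (Fin (p + 1) × Fin d) (Fin (p + 1) × Fin d) ℝ) a x,
      (companion A * M) (0, a) x = ∑ k, ∑ b, A k a b * M (k.castSucc, b) x :=
    fun M a x => companion_mulVec_zero A (fun i => M i x) a
  have hGs : ∀ (M : Matrix (Fin (p + 1) × Fin d) (Fin (p + 1) × Fin d) ℝ) (i : Fin p) a x,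
      (companion A * M) (i.succ, a) x = M (i.castSucc, a) x :=
    fun M i a x => companion_mulVec_succ A (fun i => M i x) i a
  -- With `T` symmetric, this form requires only the formulas for left multiplication by the
  -- companion matrix.
  have hFt : companion A * T * (companion A)ᵀ = (companion A * (companion A * T)ᵀ)ᵀ := by
    rw [transpose_mul, transpose_transpose]
  have hGc : ∀ a (k : Fin p) c, (companion A * T) (0, a) (k.castSucc, c) =
      γ (k + 1) a c := by
    intro a k c
    have h1 := congrFun (congrFun h.coeff a) (k, c)
    rw [coeffRow_mul_apply] at h1
    simp only [hG0, hT, toeplitz_castSucc]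
    exact h1.symm
  have hE : ∀ x y, (firstBlock d p * S * (firstBlock d p)ᵀ) x y =
      if x.1 = 0 ∧ y.1 = 0 then S x.2 y.2 else 0 := by
    rintro ⟨i, a⟩ ⟨k, b⟩
    by_cases hi : i = 0 <;> simp [Matrix.mul_apply, firstBlock, Prod.ext_iff, ite_and, hi]
  rw [IsLyapunov, hFt]
  ext ⟨i, a⟩ ⟨k, c⟩
  rw [Matrix.add_apply, transpose_apply, hE]
  induction k using Fin.cases with
  | zero =>
    rw [hG0]
    simp only [transpose_apply]
    induction i using Fin.cases with
    | zero =>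
      have h1 := congrFun (congrFun h.innov c) a
      rw [Matrix.add_apply, coeffRow_mul_apply] at h1
      simp only [hGc, and_self, if_true]
      have h2 : T (0, a) (0, c) = γ 0 c a := by
        rw [hTt']
        simp [hT, toeplitz]
      rw [h2, h1, show S c a = S a c from congrFun (congrFun hS a) c]
      rfl
    | succ i =>
      simp only [Fin.succ_ne_zero, false_and, if_false, add_zero]
      have h1 := congrFun (congrFun h.coeff c) (i, a)
      rw [coeffRow_mul_apply] at h1
      have h2 : T (i.succ, a) (0, c) = γ (i + 1) c a := by simp [hT, toeplitz]
      rw [h2]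
      refine h1.trans (Finset.sum_congr rfl fun k _ => Finset.sum_congr rfl fun b _ => ?_)
      rw [hGs, hTt', hT, toeplitz_castSucc]
  | succ k =>
    rw [hGs, transpose_apply, if_neg (fun h => Fin.succ_ne_zero _ h.2), add_zero]
    induction i using Fin.cases with
    | zero =>
      rw [hGc]
      simp [hT, toeplitz]
    | succ i => rw [hGs, hT, toeplitz_castSucc, toeplitz_succ]

theorem eq_of_toeplitz_eq {γ γ' : ℕ → Matrix (Fin d) (Fin d) ℝ} {n : ℕ}
    (h : toeplitz γ (n + 1) = toeplitz γ' (n + 1)) {k : ℕ} (hk : k ≤ n) : γ k = γ' k := by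
  ext a b
  simpa [toeplitz] using congrFun (congrFun h (0, a)) (⟨k, Nat.lt_succ_of_le hk⟩, b)

/-! ### Impulse responses -/

section impulse

open PowerSeries

variable (A : Fin p → Matrix (Fin d) (Fin d) ℝ)

/-- The power series `1 - A_1 X - ⋯ - A_p X^p`. -/
def arSeries : PowerSeries (Matrix (Fin d) (Fin d) ℝ) :=
  1 - ∑ k : Fin p, C (A k) * X ^ ((k : ℕ) + 1)

/-- The coefficients of the inverse of `1 - A_1 X - ⋯ - A_p X^p`, extended by zero to negative
indices. -/
def impulse (n : ℤ) : Matrix (Fin d) (Fin d) ℝ :=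
  if 0 ≤ n then coeff n.toNat (invOfUnit (arSeries A) 1) else 0

theorem constantCoeff_arSeries : constantCoeff (arSeries A) = ((1 : (Matrix (Fin d) (Fin d) ℝ)ˣ) :
    Matrix (Fin d) (Fin d) ℝ) := by
  simp [arSeries]

theorem impulse_of_neg {n : ℤ} (h : n < 0) : impulse A n = 0 := if_neg h.not_ge

theorem impulse_natCast (n : ℕ) : impulse A n = coeff n (invOfUnit (arSeries A) 1) := by
  simp [impulse]

theorem impulse_sub (m : ℕ) (k : ℕ) : impulse A ((m : ℤ) - (k + 1 : ℕ)) =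
    if k + 1 ≤ m then coeff (m - (k + 1)) (invOfUnit (arSeries A) 1) else 0 := by
  split_ifs with h
  · rw [← Nat.cast_sub h, impulse_natCast]
  · exact impulse_of_neg A (by omega)

/-- Matrix coefficients do not commute, so both one-sided recursions are needed: this one shows that
the filtered noise solves the autoregression, `impulse_eq_right` that filtering the innovations
recovers the path. -/
theorem impulse_eq_left (n : ℤ) : impulse A n =
    (if n = 0 then 1 else 0) + ∑ k : Fin p, A k * impulse A (n - ((k : ℕ) + 1 : ℕ)) := by
  rcases lt_or_ge n 0 with hn | hn
  · rw [impulse_of_neg A hn, if_neg hn.ne, Finset.sum_eq_zero, add_zero]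
    intro k _
    rw [impulse_of_neg A (by omega), Matrix.mul_zero]
  · lift n to ℕ using hn
    have h := congrArg (coeff n) (mul_invOfUnit (arSeries A) 1 (constantCoeff_arSeries A))
    rw [arSeries, sub_mul, one_mul, map_sub, sub_eq_iff_eq_add, ← arSeries, Finset.sum_mul,
      map_sum, coeff_one] at h
    rw [impulse_natCast, h]
    simp only [Nat.cast_eq_zero]
    congr 1
    refine Finset.sum_congr rfl fun k _ => ?_
    rw [mul_assoc, coeff_C_mul, coeff_X_pow_mul', impulse_sub]

theorem impulse_eq_right (n : ℤ) : impulse A n =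
    (if n = 0 then 1 else 0) + ∑ k : Fin p, impulse A (n - ((k : ℕ) + 1 : ℕ)) * A k := by
  rcases lt_or_ge n 0 with hn | hn
  · rw [impulse_of_neg A hn, if_neg hn.ne, Finset.sum_eq_zero, add_zero]
    intro k _
    rw [impulse_of_neg A (by omega), Matrix.zero_mul]
  · lift n to ℕ using hn
    have h := congrArg (coeff n) (invOfUnit_mul (arSeries A) 1 (constantCoeff_arSeries A))
    nth_rewrite 2 [arSeries] at h
    rw [mul_sub, mul_one, map_sub, sub_eq_iff_eq_add, Finset.mul_sum,
      map_sum, coeff_one] at h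
    rw [impulse_natCast, h]
    simp only [Nat.cast_eq_zero]
    congr 1
    refine Finset.sum_congr rfl fun k _ => ?_
    rw [← mul_assoc, coeff_mul_X_pow', impulse_sub]
    split_ifs
    · rw [coeff_mul_C]
    · rw [Matrix.zero_mul]

theorem abs_summable_impulse {A : Fin p → Matrix (Fin d) (Fin d) ℝ} (hA : IsCausalPoly A)
    (a b : Fin d) : Summable fun n : ℤ => |impulse A n a b| := by
  rw [← (Nat.cast_injective (R := ℤ)).summable_iff]
  -- The stacked responses `(Ψ_n, …, Ψ_{n-p})` evolve by the companion matrix, so they inherit the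
  -- summability of its powers.
  · set Y : ℕ → Matrix (Fin (p + 1) × Fin d) (Fin d) ℝ :=
      fun n => of fun x b => impulse A (n - (x.1 : ℕ)) x.2 b with hY
    have h1 : ∀ n, Y (n + 1) = companion A * Y n := by
      intro n
      ext ⟨i, a⟩ b
      have e0 := companion_mulVec_zero A (fun i => Y n i b) a
      induction i using Fin.cases with
      | zero =>
        refine Eq.trans ?_ e0.symm
        have h2 := congrFun (congrFun (impulse_eq_left A ((n + 1 : ℕ) : ℤ)) a) b
        rw [if_neg (by omega), zero_add, Matrix.sum_apply] at h2
        simp only [hY, of_apply, Fin.val_zero, Nat.cast_zero, sub_zero, Fin.val_castSucc]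
        rw [h2]
        refine Finset.sum_congr rfl fun k _ => ?_
        rw [Matrix.mul_apply]
        push_cast
        simp only [add_sub_add_right_eq_sub]
      | succ i =>
        refine Eq.trans ?_ (companion_mulVec_succ A (fun i => Y n i b) i a).symm
        simp [hY]
    have h3 : ∀ n, Y n = companion A ^ n * Y 0 := by
      intro n
      induction n with
      | zero => simp
      | succ n ih => rw [h1, ih, pow_succ', Matrix.mul_assoc]
    have h4 : ∀ n : ℕ, impulse A n a b = ∑ x, (companion A ^ n) (0, a) x * Y 0 x b := by
      intro n
      have := congrFun (congrFun (h3 n) (0, a)) b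
      rw [Matrix.mul_apply] at this
      rw [← this]
      simp [hY]
    refine Summable.of_nonneg_of_le (fun _ => abs_nonneg _) (fun n => ?_)
      (summable_sum fun x (_ : x ∈ Finset.univ) =>
        (summable_companion_pow hA (0, a) x).mul_right |Y 0 x b|)
    rw [Function.comp_apply, h4]
    refine (Finset.abs_sum_le_sum_abs _ _).trans_eq (Finset.sum_congr rfl fun x _ => abs_mul _ _)
  · intro n hn
    rw [impulse_of_neg A, Matrix.zero_apply, abs_zero]
    by_contra h
    exact hn ⟨n.toNat, by simpa using h⟩

theorem summable_norm_impulse {A : Fin p → Matrix (Fin d) (Fin d) ℝ} (hA : IsCausalPoly A) :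
    Summable fun n : ℤ => ‖toEuclideanCLM (𝕜 := ℝ) (impulse A n)‖ := by
  refine Summable.of_nonneg_of_le (fun _ => norm_nonneg _) (fun n => ?_)
    (summable_sum fun a (_ : a ∈ Finset.univ) => summable_sum fun b (_ : b ∈ Finset.univ) =>
      (abs_summable_impulse hA a b).mul_right
        ‖toEuclideanCLM (𝕜 := ℝ) (single a b (1 : ℝ))‖)
  conv_lhs => rw [matrix_eq_sum_single (impulse A n)]
  simp only [map_sum]
  refine (norm_sum_le _ _).trans (Finset.sum_le_sum fun a _ => (norm_sum_le _ _).trans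
    (Finset.sum_le_sum fun b _ => ?_))
  have : single a b (impulse A n a b) = impulse A n a b • single a b (1 : ℝ) := by
    rw [smul_single, smul_eq_mul, mul_one]
  rw [this, map_smul, norm_smul, Real.norm_eq_abs]

end impulse

end VAR


namespace VAR

open Matrix Filter Topology

/-! ### Linear filters on two-sided paths -/

section filter

variable {E : Type*} [NormedAddCommGroup E] [NormedSpace ℝ E]

/-- The path `t ↦ ∑ n, ψ n (z (t - n))`. -/
def linearFilter (ψ : ℤ → E →L[ℝ] E) (z : ℤ → E) (t : ℤ) : E := ∑' n, ψ n (z (t - n))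

/-- The series defining the filtered path converge absolutely. -/
def FilterSummable (ψ : ℤ → E →L[ℝ] E) (z : ℤ → E) : Prop :=
  ∀ t, Summable fun n => ‖ψ n‖ * ‖z (t - n)‖

variable {ψ : ℤ → E →L[ℝ] E} {z : ℤ → E}

theorem FilterSummable.hasSum [CompleteSpace E] (hz : FilterSummable ψ z) (t : ℤ) :
    HasSum (fun n => ψ n (z (t - n))) (linearFilter ψ z t) :=
  (Summable.of_norm_bounded (hz t) fun n => (ψ n).le_opNorm _).hasSum

theorem linearFilter_shift (z : ℤ → E) (h t : ℤ) :
    linearFilter ψ (fun s => z (s + h)) t = linearFilter ψ z (t + h) := by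
  simp only [linearFilter, sub_add_eq_add_sub]

variable [MeasurableSpace E] [BorelSpace E]
  {μ : Measure (ℤ → E)} {ν : Measure E}

/-- All coordinates share the law `ν`, so the expectation of the series of norms is `(∑ ‖ψ n‖)
E‖x‖`, which is finite. -/
theorem ae_filterSummable (hψ : Summable fun n => ‖ψ n‖)
    (hμ : ∀ t, MeasurePreserving (fun x : ℤ → E => x t) μ ν) (hν : Integrable id ν) :
    ∀ᵐ x ∂μ, FilterSummable ψ x := by
  refine ae_all_iff.2 fun t => ?_
  have hm : ∀ n, Measurable fun x : ℤ → E => ‖ψ n‖ₑ * ‖x (t - n)‖ₑ := fun n =>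
    (measurable_pi_apply (t - n)).enorm.const_mul _
  have h1 : ∫⁻ x, ∑' n, ‖ψ n‖ₑ * ‖x (t - n)‖ₑ ∂μ ≠ ⊤ := by
    rw [lintegral_tsum fun n => (hm n).aemeasurable]
    have h2 : ∀ n, ∫⁻ x, ‖ψ n‖ₑ * ‖x (t - n)‖ₑ ∂μ = ‖ψ n‖ₑ * ∫⁻ y, ‖y‖ₑ ∂ν := fun n => by
      rw [lintegral_const_mul _ (measurable_pi_apply (t - n)).enorm,
        ← (hμ (t - n)).lintegral_comp measurable_enorm]
    simp only [h2]
    rw [ENNReal.tsum_mul_right]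
    refine ENNReal.mul_ne_top ?_ hν.2.ne
    have := hψ.tsum_ofReal_ne_top
    simpa only [ofReal_norm] using this
  filter_upwards [ae_lt_top (.tsum hm) h1] with x hx
  have := ENNReal.summable_toReal hx.ne
  simpa only [ENNReal.toReal_mul, toReal_enorm] using this

variable [SecondCountableTopology E] [CompleteSpace E]

/-- The `tsum` takes a default value where it diverges, so the filter is identified with a limit of
finite sums only almost everywhere. -/
theorem aemeasurable_linearFilter (h : ∀ᵐ x ∂μ, FilterSummable ψ x) :
    AEMeasurable (linearFilter ψ) μ := by
  refine aemeasurable_pi_iff.2 fun t => ?_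
  refine aemeasurable_of_tendsto_metrizable_ae (atTop : Filter (Finset ℤ))
    (f := fun s x => ∑ n ∈ s, ψ n (x (t - n))) (fun s => ?_) ?_
  · exact (Finset.measurable_sum _ fun n _ =>
      (ψ n).measurable.comp (measurable_pi_apply (t - n))).aemeasurable
  · filter_upwards [h] with x hx
    exact hx.hasSum t

theorem memLp_linearFilter (hψ : Summable fun n => ‖ψ n‖)
    (hμ : ∀ t, MeasurePreserving (fun x : ℤ → E => x t) μ ν) (hν : MemLp id 2 ν)
    (h : ∀ᵐ x ∂μ, FilterSummable ψ x) (t : ℤ) :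
    MemLp (fun x => linearFilter ψ x t) 2 μ := by
  have hLp : ∀ s, MemLp (fun x : ℤ → E => x s) 2 μ := fun s => by
    have := hν.comp_measurePreserving (hμ s)
    rwa [Function.id_comp] at this
  have hnorm : ∀ s, eLpNorm (fun x : ℤ → E => x s) 2 μ = eLpNorm id 2 ν := fun s => by
    have := eLpNorm_comp_measurePreserving (p := 2) hν.1 (hμ s)
    rwa [Function.id_comp] at this
  refine ⟨(aemeasurable_pi_iff.1 (aemeasurable_linearFilter h) t).aestronglyMeasurable, ?_⟩
  -- Fatou's lemma is applied along a sequence of finite sets; Minkowski's inequality bounds the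
  -- partial sums uniformly.
  obtain ⟨v, hv⟩ := (atTop : Filter (Finset ℤ)).exists_seq_tendsto
  have hF : ∀ n, MemLp (fun x : ℤ → E => ψ n (x (t - n))) 2 μ := fun n =>
    (ψ n).comp_memLp' (hLp (t - n))
  have h1 := Lp.eLpNorm_lim_le_liminf_eLpNorm (p := 2) (μ := μ)
    (f := fun N x => ∑ n ∈ v N, ψ n (x (t - n)))
    (fun N => (memLp_finsetSum _ fun n _ => hF n).1) (fun x => linearFilter ψ x t) (by
      filter_upwards [h] with x hx
      have ht : Tendsto (fun s : Finset ℤ => ∑ n ∈ s, ψ n (x (t - n))) atTop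
        (𝓝 (linearFilter ψ x t)) := hx.hasSum t
      exact ht.comp hv)
  have hC : (∑' n, ‖ψ n‖ₑ) * eLpNorm id 2 ν < ⊤ := by
    refine ENNReal.mul_lt_top ?_ hν.2
    have := hψ.tsum_ofReal_lt_top
    simpa only [ofReal_norm] using this
  refine (h1.trans (liminf_le_of_le (h := ?_))).trans_lt hC
  intro b hb
  obtain ⟨N, hN⟩ := hb.exists
  refine hN.trans ?_
  calc eLpNorm (fun x => ∑ n ∈ v N, ψ n (x (t - n))) 2 μ
      ≤ ∑ n ∈ v N, eLpNorm (fun x => ψ n (x (t - n))) 2 μ := by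
        have := eLpNorm_sum_le (s := v N) (f := fun n (x : ℤ → E) => ψ n (x (t - n))) (μ := μ)
          (p := 2) (fun n _ => (hF n).1) (by norm_num)
        refine le_trans (le_of_eq ?_) this
        congr 1
        ext x
        simp
    _ ≤ ∑ n ∈ v N, ‖ψ n‖ₑ * eLpNorm id 2 ν := Finset.sum_le_sum fun n _ => by
        rw [← hnorm (t - n)]
        refine eLpNorm_le_mul_eLpNorm_of_ae_le_mul' (c := ‖ψ n‖₊) (ae_of_all _ fun x => ?_) 2
        exact (ψ n).le_opENorm _
    _ ≤ ∑' n, ‖ψ n‖ₑ * eLpNorm id 2 ν := ENNReal.sum_le_tsum _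
    _ = _ := ENNReal.tsum_mul_right

theorem integral_linearFilter_eq_zero (hψ : Summable fun n => ‖ψ n‖)
    (hμ : ∀ t, MeasurePreserving (fun x : ℤ → E => x t) μ ν) (hν : Integrable id ν)
    (hν0 : ∫ y, y ∂ν = 0) (t : ℤ) : ∫ x, linearFilter ψ x t ∂μ = 0 := by
  have hi : ∀ s, Integrable (fun x : ℤ → E => x s) μ := fun s =>
    (hμ s).integrable_comp_of_integrable hν
  have hi0 : ∀ s, ∫ x : ℤ → E, x s ∂μ = 0 := fun s => by
    have := integral_map (hμ s).aemeasurable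
      (aestronglyMeasurable_id (μ := μ.map fun x : ℤ → E => x s))
    rw [(hμ s).map_eq] at this
    exact this.symm.trans hν0
  have hin : ∀ s, ∫ x : ℤ → E, ‖x s‖ ∂μ = ∫ y, ‖y‖ ∂ν := fun s => by
    rw [← (hμ s).map_eq, integral_map (hμ s).aemeasurable
      continuous_norm.aestronglyMeasurable]
  have h1 := integral_tsum_of_summable_integral_norm (μ := μ)
    (F := fun n (x : ℤ → E) => ψ n (x (t - n))) (fun n => (ψ n).integrable_comp (hi _)) (by
      refine Summable.of_nonneg_of_le (fun n => integral_nonneg fun _ => norm_nonneg _)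
        (fun n => ?_) (hψ.mul_right (∫ y, ‖y‖ ∂ν))
      rw [← hin (t - n), ← integral_const_mul]
      exact integral_mono ((ψ n).integrable_comp (hi _)).norm ((hi _).norm.const_mul _)
        fun x => (ψ n).le_opNorm _)
  simp only [linearFilter]
  rw [← h1]
  simp only [ContinuousLinearMap.integral_comp_comm _ (hi _), hi0, map_zero, tsum_zero]

end filter

/-! ### Inverting the autoregression -/

section inversion

variable {d p : ℕ}

/-- The impulse responses as operators. -/
def impulseOp (A : Fin p → Matrix (Fin d) (Fin d) ℝ) (n : ℤ) :
    EuclideanSpace ℝ (Fin d) →L[ℝ] EuclideanSpace ℝ (Fin d) :=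
  toEuclideanCLM (𝕜 := ℝ) (impulse A n)

variable (A : Fin p → Matrix (Fin d) (Fin d) ℝ) {z : ℤ → EuclideanSpace ℝ (Fin d)}

theorem hasSum_shift {F : ℤ → EuclideanSpace ℝ (Fin d)} {s : EuclideanSpace ℝ (Fin d)}
    (h : HasSum F s) (m : ℤ) : HasSum (fun n => F (n - m)) s :=
  (Equiv.subRight m).hasSum_iff.2 h

theorem impulseOp_eq_left (n : ℤ) (v : EuclideanSpace ℝ (Fin d)) :
    impulseOp A n v = (if n = 0 then v else 0) +
      ∑ k : Fin p, toEuclideanCLM (𝕜 := ℝ) (A k) (impulseOp A (n - ((k : ℕ) + 1 : ℕ)) v) := by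
  have h := congrArg (fun M => toEuclideanCLM (𝕜 := ℝ) M v) (impulse_eq_left A n)
  simp only [map_add, map_sum, map_mul] at h
  rw [impulseOp, h, _root_.add_apply, _root_.sum_apply]
  congr 1
  split_ifs <;> simp

theorem impulseOp_eq_right (n : ℤ) (v : EuclideanSpace ℝ (Fin d)) :
    impulseOp A n v = (if n = 0 then v else 0) +
      ∑ k : Fin p, impulseOp A (n - ((k : ℕ) + 1 : ℕ)) (toEuclideanCLM (𝕜 := ℝ) (A k) v) := by
  have h := congrArg (fun M => toEuclideanCLM (𝕜 := ℝ) M v) (impulse_eq_right A n)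
  simp only [map_add, map_sum, map_mul] at h
  rw [impulseOp, h, _root_.add_apply, _root_.sum_apply]
  congr 1
  split_ifs <;> simp

/-- After the `k`-th series is shifted by `k + 1`, the recursion for the impulse responses cancels
every term except `Ψ_0 z_t`. -/
theorem innovation_linearFilter (hz : FilterSummable (impulseOp A) z) (t : ℤ) :
    innovation A t (linearFilter (impulseOp A) z) = z t := by
  have h1 : ∀ k : Fin p, HasSum
      (fun n => toEuclideanCLM (𝕜 := ℝ) (A k) (impulseOp A (n - ((k : ℕ) + 1 : ℕ)) (z (t - n))))
      (toEuclideanCLM (𝕜 := ℝ) (A k)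
        (linearFilter (impulseOp A) z (t - ((k : ℕ) + 1 : ℕ)))) := by
    intro k
    have h2 := hasSum_shift ((hz.hasSum (t - ((k : ℕ) + 1 : ℕ))).mapL
      (toEuclideanCLM (𝕜 := ℝ) (A k))) ((k : ℕ) + 1 : ℕ)
    simpa only [sub_sub_sub_cancel_right] using h2
  have h3 := (hz.hasSum t).sub (hasSum_sum fun k (_ : k ∈ Finset.univ) => h1 k)
  refine h3.unique ?_
  have h4 : HasSum (fun n => if n = (0 : ℤ) then z t else 0) (z t) := hasSum_ite_eq 0 (z t)
  refine h4.congr_fun fun n => ?_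
  rw [impulseOp_eq_left, add_sub_cancel_right]
  split_ifs with hn
  · rw [hn, sub_zero]
  · rfl

theorem linearFilter_innovation (hz : FilterSummable (impulseOp A) z) :
    linearFilter (impulseOp A) (fun t => innovation A t z) = z := by
  funext t
  have hs : ∀ k : Fin p, Summable fun n => impulseOp A n
      (toEuclideanCLM (𝕜 := ℝ) (A k) (z (t - n - ((k : ℕ) + 1 : ℕ)))) := by
    intro k
    refine Summable.of_norm_bounded
      ((hz (t - ((k : ℕ) + 1 : ℕ))).mul_left ‖toEuclideanCLM (𝕜 := ℝ) (A k)‖) fun n => ?_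
    rw [sub_right_comm t n]
    calc _ ≤ ‖impulseOp A n‖ * (‖toEuclideanCLM (𝕜 := ℝ) (A k)‖ *
          ‖z (t - ((k : ℕ) + 1 : ℕ) - n)‖) :=
          ((impulseOp A n).le_opNorm _).trans (mul_le_mul_of_nonneg_left
            (ContinuousLinearMap.le_opNorm _ _) (norm_nonneg _))
      _ = _ := by ring
  have h1 := (hz.hasSum t).sub (hasSum_sum fun k (_ : k ∈ Finset.univ) => (hs k).hasSum)
  have h2 : HasSum (fun n => impulseOp A n (innovation A (t - n) z)) _ := h1.congr_fun fun n => by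
    rw [innovation, map_sub, map_sum]
  have h3 := (hz.hasSum t).sub (hasSum_sum fun k (_ : k ∈ Finset.univ) =>
    hasSum_shift (hs k).hasSum ((k : ℕ) + 1 : ℕ))
  refine h2.tsum_eq.trans (h3.unique ?_)
  have h4 : HasSum (fun n => if n = (0 : ℤ) then z t else 0) (z t) := hasSum_ite_eq 0 (z t)
  refine h4.congr_fun fun n => ?_
  simp only [sub_sub, sub_add_cancel]
  rw [impulseOp_eq_right, add_sub_cancel_right]
  split_ifs with hn
  · rw [hn, sub_zero]
  · rfl

theorem measurable_innovation (t : ℤ) : Measurable (innovation A t) := by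
  unfold innovation
  fun_prop

end inversion

end VAR


namespace VAR

open Matrix Filter Topology

variable {d p : ℕ} {A : Fin p → Matrix (Fin d) (Fin d) ℝ} {S : Matrix (Fin d) (Fin d) ℝ}
  {P : Measure (ℤ → EuclideanSpace ℝ (Fin d))}

/-! ### The law of a causal VAR process -/

/-- The law of independent `N(0, S)` innovations. -/
def noiseLaw (S : Matrix (Fin d) (Fin d) ℝ) : Measure (ℤ → EuclideanSpace ℝ (Fin d)) :=
  Measure.infinitePi fun _ : ℤ => multivariateGaussian 0 S

instance (S : Matrix (Fin d) (Fin d) ℝ) : IsProbabilityMeasure (noiseLaw S) := by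
  unfold noiseLaw
  infer_instance

/-- The law of the causal moving average `X_t = ∑ n ≥ 0, Ψ_n Z_{t-n}`. -/
def causalLaw (A : Fin p → Matrix (Fin d) (Fin d) ℝ) (S : Matrix (Fin d) (Fin d) ℝ) :
    Measure (ℤ → EuclideanSpace ℝ (Fin d)) :=
  (noiseLaw S).map (linearFilter (impulseOp A))

theorem measurePreserving_eval_noiseLaw (S : Matrix (Fin d) (Fin d) ℝ) (t : ℤ) :
    MeasurePreserving (fun z : ℤ → EuclideanSpace ℝ (Fin d) => z t) (noiseLaw S)
      (multivariateGaussian 0 S) :=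
  measurePreserving_eval_infinitePi _ t

theorem noiseLaw_map_shift (S : Matrix (Fin d) (Fin d) ℝ) (h : ℤ) :
    (noiseLaw S).map (fun (z : ℤ → EuclideanSpace ℝ (Fin d)) (t : ℤ) => z (t + h)) =
      noiseLaw S :=
  Measure.map_infinitePi_infinitePi_of_inj (add_left_injective h)

theorem memLp_id_multivariateGaussian (S : Matrix (Fin d) (Fin d) ℝ) :
    MemLp id 2 (multivariateGaussian (0 : EuclideanSpace ℝ (Fin d)) S) :=
  IsGaussian.memLp_two_id

theorem ae_filterSummable_noiseLaw (hA : IsCausalPoly A) :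
    ∀ᵐ z ∂noiseLaw S, FilterSummable (impulseOp A) z :=
  ae_filterSummable (summable_norm_impulse hA) (measurePreserving_eval_noiseLaw S)
    ((memLp_id_multivariateGaussian S).integrable one_le_two)

theorem aemeasurable_linearFilter_noiseLaw (hA : IsCausalPoly A) :
    AEMeasurable (linearFilter (impulseOp A)) (noiseLaw S) :=
  aemeasurable_linearFilter (ae_filterSummable_noiseLaw hA)

theorem measurable_innovation_path (A : Fin p → Matrix (Fin d) (Fin d) ℝ) :
    Measurable fun (x : ℤ → EuclideanSpace ℝ (Fin d)) (t : ℤ) => innovation A t x :=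
  measurable_pi_iff.2 (measurable_innovation A)

theorem causalLaw_map_innovation (hA : IsCausalPoly A) :
    (causalLaw A S).map (fun x t => innovation A t x) = noiseLaw S := by
  rw [causalLaw, AEMeasurable.map_map_of_aemeasurable
    (measurable_innovation_path A).aemeasurable (aemeasurable_linearFilter_noiseLaw hA)]
  have : (fun x t => innovation A t x) ∘ linearFilter (impulseOp A) =ᵐ[noiseLaw S] id := by
    filter_upwards [ae_filterSummable_noiseLaw hA] with z hz
    funext t
    exact innovation_linearFilter A hz t
  rw [Measure.map_congr this, Measure.map_id]

/-- The innovation path of the filtered noise is the noise itself, which gives both the marginals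
and the independence; stationarity holds because filtering commutes with shifts. -/
theorem isCausalVAR_causalLaw (hA : IsCausalPoly A) (hS : S.PosDef) :
    IsCausalVAR A S (causalLaw A S) := by
  have hm := aemeasurable_linearFilter_noiseLaw (S := S) hA
  have hprob : IsProbabilityMeasure (causalLaw A S) := Measure.isProbabilityMeasure_map hm
  have hinn : ∀ t : ℤ, (causalLaw A S).map (innovation A t) = multivariateGaussian 0 S := by
    intro t
    have h1 := congrArg (Measure.map fun z : ℤ → EuclideanSpace ℝ (Fin d) => z t)
      (causalLaw_map_innovation (S := S) hA)
    rwa [Measure.map_map (measurable_pi_apply t) (measurable_innovation_path A),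
      (measurePreserving_eval_noiseLaw S t).map_eq] at h1
  refine ⟨hprob, fun t => ?_, fun t => ?_, fun h => ?_, hS, hinn, ?_, hA⟩
  · rw [causalLaw, memLp_map_measure_iff (measurable_pi_apply t).aestronglyMeasurable hm]
    exact memLp_linearFilter (summable_norm_impulse hA) (measurePreserving_eval_noiseLaw S)
      (memLp_id_multivariateGaussian S) (ae_filterSummable_noiseLaw hA) t
  · rw [causalLaw, integral_map hm (measurable_pi_apply t).aestronglyMeasurable]
    exact integral_linearFilter_eq_zero (summable_norm_impulse hA)
      (measurePreserving_eval_noiseLaw S)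
      ((memLp_id_multivariateGaussian S).integrable one_le_two)
      integral_id_multivariateGaussian t
  · have hsm : Measurable fun (z : ℤ → EuclideanSpace ℝ (Fin d)) (t : ℤ) => z (t + h) :=
      measurable_pi_iff.2 fun t => measurable_pi_apply (t + h)
    have hm' : AEMeasurable (linearFilter (impulseOp A))
        ((noiseLaw S).map fun z (t : ℤ) => z (t + h)) := by rwa [noiseLaw_map_shift]
    have hcomp : (fun (z : ℤ → EuclideanSpace ℝ (Fin d)) (t : ℤ) => z (t + h)) ∘
        linearFilter (impulseOp A) = linearFilter (impulseOp A) ∘ fun z t => z (t + h) := by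
      funext z t
      exact (linearFilter_shift z h t).symm
    rw [causalLaw, AEMeasurable.map_map_of_aemeasurable hsm.aemeasurable hm, hcomp,
      ← AEMeasurable.map_map_of_aemeasurable hm' hsm.aemeasurable, noiseLaw_map_shift]
  · rw [iIndepFun_iff_map_fun_eq_infinitePi_map (measurable_innovation A)]
    simp only [hinn]
    exact causalLaw_map_innovation hA

theorem IsCausalVAR.isCausalPoly (h : IsCausalVAR A S P) : IsCausalPoly A := h.causal

theorem IsCausalVAR.map_innovation (h : IsCausalVAR A S P) :
    P.map (fun x t => innovation A t x) = noiseLaw S := by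
  have := h.isProbabilityMeasure
  have h1 := (iIndepFun_iff_map_fun_eq_infinitePi_map (measurable_innovation A)).1
    h.innovation_indep
  simp only [h.innovation_law] at h1
  exact h1

/-- Stationarity gives the coordinates a common integrable law, so the filter converges almost
surely on innovations and on paths alike. Filtering the innovations then returns the path, and the
innovations have the noise law. -/
theorem IsCausalVAR.eq_causalLaw (h : IsCausalVAR A S P) : P = causalLaw A S := by
  have hA := h.isCausalPoly
  have hmp : ∀ t, MeasurePreserving (fun x : ℤ → EuclideanSpace ℝ (Fin d) => x t) P
      (P.map fun x => x 0) := fun t => by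
    refine ⟨measurable_pi_apply t, ?_⟩
    have e := Measure.map_map (μ := P) (g := fun x : ℤ → EuclideanSpace ℝ (Fin d) => x 0)
      (f := fun x s => x (s + t)) (measurable_pi_apply 0)
      (measurable_pi_iff.2 fun s => measurable_pi_apply (s + t))
    rw [h.stationary t] at e
    rw [e]
    congr 1
    funext x
    simp
  have hae : ∀ᵐ x ∂P, FilterSummable (impulseOp A) x := by
    have := h.isProbabilityMeasure
    refine ae_filterSummable (summable_norm_impulse hA) hmp ?_
    exact (integrable_map_measure (f := fun x : ℤ → EuclideanSpace ℝ (Fin d) => x 0)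
      aestronglyMeasurable_id (measurable_pi_apply 0).aemeasurable).2
      ((h.memLp_two 0).integrable one_le_two)
  have hm : AEMeasurable (linearFilter (impulseOp A))
      (P.map fun x t => innovation A t x) := by
    rw [h.map_innovation]
    exact aemeasurable_linearFilter_noiseLaw hA
  have hid : linearFilter (impulseOp A) ∘ (fun x t => innovation A t x) =ᵐ[P] id := by
    filter_upwards [hae] with x hx
    exact linearFilter_innovation A hx
  rw [causalLaw, ← h.map_innovation,
    AEMeasurable.map_map_of_aemeasurable hm (measurable_innovation_path A).aemeasurable,
    Measure.map_congr hid, Measure.map_id]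

/-! ### Second moments -/

theorem memLp_euclideanSpace_apply {Ω' : Type*} [MeasurableSpace Ω'] {μ : Measure Ω'}
    {f : Ω' → EuclideanSpace ℝ (Fin d)} (h : MemLp f 2 μ) (a : Fin d) :
    MemLp (fun ω => f ω a) 2 μ :=
  (EuclideanSpace.proj a : EuclideanSpace ℝ (Fin d) →L[ℝ] ℝ).comp_memLp' h

/-- The factor `‖L‖` makes the products of `z t` with the terms of the filter summable in `L¹`, so
that expectation and series can be exchanged. -/
theorem norm_apply_mul_apply_le (L : EuclideanSpace ℝ (Fin d) →L[ℝ] EuclideanSpace ℝ (Fin d))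
    (x y : EuclideanSpace ℝ (Fin d)) (a b : Fin d) :
    ‖x a * (L y) b‖ ≤ ‖L‖ * (‖x‖ ^ 2 + ‖y‖ ^ 2) := by
  have h1 : ‖x a‖ ≤ ‖x‖ := PiLp.norm_apply_le x a
  have h2 : ‖(L y) b‖ ≤ ‖L‖ * ‖y‖ := (PiLp.norm_apply_le (L y) b).trans (L.le_opNorm y)
  calc ‖x a * (L y) b‖ ≤ ‖x‖ * (‖L‖ * ‖y‖) := by
        rw [norm_mul]
        exact mul_le_mul h1 h2 (norm_nonneg _) (norm_nonneg _)
    _ = ‖L‖ * (‖x‖ * ‖y‖) := by ring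
    _ ≤ ‖L‖ * (‖x‖ ^ 2 + ‖y‖ ^ 2) := by
        refine mul_le_mul_of_nonneg_left ?_ (norm_nonneg _)
        nlinarith [sq_nonneg (‖x‖ - ‖y‖), sq_nonneg (‖x‖ + ‖y‖)]

/-- Innovations are uncorrelated with the past of the filtered process. -/
theorem covariance_linearFilter_noiseLaw (hA : IsCausalPoly A) {t u : ℤ} (hut : u < t)
    (a b : Fin d) :
    cov[fun z => z t a, fun z => linearFilter (impulseOp A) z u b; noiseLaw S] = 0 := by
  have hψ : Summable fun n => ‖impulseOp A n‖ := summable_norm_impulse hA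
  have hmp := measurePreserving_eval_noiseLaw S
  have hG2 := memLp_id_multivariateGaussian S
  have hL : ∀ s, MemLp (fun z : ℤ → EuclideanSpace ℝ (Fin d) => z s) 2 (noiseLaw S) :=
    fun s => by
      have := hG2.comp_measurePreserving (hmp s)
      rwa [Function.id_comp] at this
  have hae := ae_filterSummable_noiseLaw (S := S) hA
  have hX := memLp_linearFilter hψ hmp hG2 hae u
  have hz0 : ∀ s c, ∫ z : ℤ → EuclideanSpace ℝ (Fin d), z s c ∂noiseLaw S = 0 := fun s c => by
    have h1 : ∫ z : ℤ → EuclideanSpace ℝ (Fin d), z s ∂noiseLaw S = 0 := by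
      have := integral_map (hmp s).aemeasurable (aestronglyMeasurable_id
        (μ := (noiseLaw S).map fun z : ℤ → EuclideanSpace ℝ (Fin d) => z s))
      rw [(hmp s).map_eq] at this
      exact this.symm.trans integral_id_multivariateGaussian
    have h2 := (EuclideanSpace.proj c : EuclideanSpace ℝ (Fin d) →L[ℝ] ℝ).integral_comp_comm
      ((hL s).integrable one_le_two)
    rw [h1, map_zero] at h2
    exact h2
  rw [covariance_eq_sub (memLp_euclideanSpace_apply (hL t) a) (memLp_euclideanSpace_apply hX b), hz0, zero_mul, sub_zero]
  set F : ℤ → (ℤ → EuclideanSpace ℝ (Fin d)) → ℝ :=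
    fun n z => z t a * (impulseOp A n (z (u - n))) b with hF
  have hFL : ∀ n, MemLp (fun z : ℤ → EuclideanSpace ℝ (Fin d) => (impulseOp A n (z (u - n))) b)
      2 (noiseLaw S) := fun n =>
    memLp_euclideanSpace_apply ((impulseOp A n).comp_memLp' (hL (u - n))) b
  have hFi : ∀ n, Integrable (F n) (noiseLaw S) := fun n =>
    (memLp_euclideanSpace_apply (hL t) a).integrable_mul (hFL n)
  have hF0 : ∀ n, ∫ z, F n z ∂noiseLaw S = 0 := by
    intro n
    -- Here causality enters: for `n < 0` the coefficient vanishes, and for `n ≥ 0` the index `u -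
    -- n` is less than `t`, so the two noise coordinates are independent.
    rcases lt_or_ge n 0 with hn | hn
    · simp [hF, impulseOp, impulse_of_neg A hn]
    · have hind : IndepFun (fun z : ℤ → EuclideanSpace ℝ (Fin d) => z t) (fun z => z (u - n))
          (noiseLaw S) :=
        (iIndepFun_infinitePi (P := fun _ : ℤ => multivariateGaussian 0 S)
          (X := fun _ x => x) fun _ => measurable_id).indepFun (by omega)
      have hind2 := hind.comp (φ := fun x : EuclideanSpace ℝ (Fin d) => x a)
        (ψ := fun x : EuclideanSpace ℝ (Fin d) => (impulseOp A n x) b)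
        (by fun_prop) (by fun_prop)
      have := hind2.integral_fun_mul_eq_mul_integral (memLp_euclideanSpace_apply (hL t) a).1 (hFL n).1
      simp only [Function.comp_apply] at this
      rw [hF]
      rw [this, hz0, zero_mul]
  have hsq : ∀ s, ∫ z : ℤ → EuclideanSpace ℝ (Fin d), ‖z s‖ ^ 2 ∂noiseLaw S =
      ∫ y, ‖y‖ ^ 2 ∂(multivariateGaussian (0 : EuclideanSpace ℝ (Fin d)) S) := fun s => by
    rw [← (hmp s).map_eq, integral_map (hmp s).aemeasurable (by fun_prop)]
  have hsqi : ∀ s, Integrable (fun z : ℤ → EuclideanSpace ℝ (Fin d) => ‖z s‖ ^ 2)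
      (noiseLaw S) := fun s => (hL s).integrable_norm_pow two_ne_zero
  have hsum : Summable fun n => ∫ z, ‖F n z‖ ∂noiseLaw S := by
    refine Summable.of_nonneg_of_le (fun n => integral_nonneg fun _ => norm_nonneg _)
      (fun n => ?_) (hψ.mul_right (∫ y, ‖y‖ ^ 2 ∂(multivariateGaussian 0 S) +
        ∫ y, ‖y‖ ^ 2 ∂(multivariateGaussian (0 : EuclideanSpace ℝ (Fin d)) S)))
    have h2 := integral_mono (hFi n).norm
      (((hsqi t).add (hsqi (u - n))).const_mul ‖impulseOp A n‖)
      fun z => norm_apply_mul_apply_le (impulseOp A n) (z t) (z (u - n)) a b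
    refine h2.trans_eq ?_
    rw [integral_const_mul]
    exact congrArg _ ((integral_add (hsqi t) (hsqi (u - n))).trans (by rw [hsq t, hsq (u - n)]))
  have h1 := integral_tsum_of_summable_integral_norm hFi hsum
  simp only [hF0, tsum_zero] at h1
  rw [h1]
  refine integral_congr_ae ?_
  filter_upwards [hae] with z hz
  have h2 := ((hz.hasSum u).mapL (EuclideanSpace.proj b : EuclideanSpace ℝ (Fin d) →L[ℝ] ℝ)).mul_left
    (z t a)
  exact h2.tsum_eq.symm

end VAR


namespace VAR

open Matrix

variable {d p : ℕ} {A : Fin p → Matrix (Fin d) (Fin d) ℝ} {S : Matrix (Fin d) (Fin d) ℝ}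
  {P : Measure (ℤ → EuclideanSpace ℝ (Fin d))}

/-! ### Autocovariances of causal VAR processes -/

theorem IsCausalVAR.memLp_apply (h : IsCausalVAR A S P) (t : ℤ) (a : Fin d) :
    MemLp (fun x : ℤ → EuclideanSpace ℝ (Fin d) => x t a) 2 P :=
  memLp_euclideanSpace_apply (h.memLp_two t) a

theorem apply_eq_innovation_add (A : Fin p → Matrix (Fin d) (Fin d) ℝ)
    (x : ℤ → EuclideanSpace ℝ (Fin d)) (t : ℤ) (a : Fin d) :
    x t a = innovation A t x a +
      ∑ k : Fin p, ∑ c, A k a c * x (t - ((k : ℕ) + 1 : ℕ)) c := by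
  have h : x t = innovation A t x +
      ∑ k : Fin p, toEuclideanCLM (𝕜 := ℝ) (A k) (x (t - ((k : ℕ) + 1 : ℕ))) := by
    rw [innovation, sub_add_cancel]
  conv_lhs => rw [h]
  rw [PiLp.add_apply, WithLp.ofLp_sum, Finset.sum_apply]
  simp only [ofLp_toEuclideanCLM, mulVec, dotProduct]

theorem IsCausalVAR.memLp_innovation (h : IsCausalVAR A S P) (t : ℤ) (a : Fin d) :
    MemLp (fun x => innovation A t x a) 2 P := by
  have h1 : (fun x => innovation A t x a) = fun x : ℤ → EuclideanSpace ℝ (Fin d) =>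
      x t a - ∑ k : Fin p, ∑ c, A k a c * x (t - ((k : ℕ) + 1 : ℕ)) c := by
    funext x
    rw [apply_eq_innovation_add A x t a, add_sub_cancel_right]
  rw [h1]
  exact (h.memLp_apply t a).sub (memLp_finsetSum _ fun k _ => memLp_finsetSum _ fun c _ =>
    (h.memLp_apply _ c).const_mul _)

theorem IsCausalVAR.covariance_eq (h : IsCausalVAR A S P) (t : ℤ) (a : Fin d)
    {Y : (ℤ → EuclideanSpace ℝ (Fin d)) → ℝ} (hY : MemLp Y 2 P) :
    cov[fun x => x t a, Y; P] = cov[fun x => innovation A t x a, Y; P] +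
      ∑ k : Fin p, ∑ c, A k a c * cov[fun x => x (t - ((k : ℕ) + 1 : ℕ)) c, Y; P] := by
  have := h.isProbabilityMeasure
  have h1 : (fun x : ℤ → EuclideanSpace ℝ (Fin d) => x t a) =
      (fun x => innovation A t x a) + fun x => ∑ k : Fin p, ∑ c,
        A k a c * x (t - ((k : ℕ) + 1 : ℕ)) c :=
    funext fun x => apply_eq_innovation_add A x t a
  have h2 : ∀ (k : Fin p) (c : Fin d), MemLp
      (fun x : ℤ → EuclideanSpace ℝ (Fin d) => A k a c * x (t - ((k : ℕ) + 1 : ℕ)) c) 2 P :=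
    fun k c => (h.memLp_apply _ c).const_mul _
  have h3 : ∀ k : Fin p, MemLp (fun x : ℤ → EuclideanSpace ℝ (Fin d) =>
      ∑ c, A k a c * x (t - ((k : ℕ) + 1 : ℕ)) c) 2 P :=
    fun k => memLp_finsetSum _ fun c _ => h2 k c
  rw [h1, covariance_add_left (h.memLp_innovation t a) (memLp_finsetSum _ fun k _ => h3 k) hY,
    covariance_fun_sum_left h3 hY]
  simp only [covariance_fun_sum_left (h2 _) hY, covariance_const_mul_left]

theorem IsCausalVAR.covariance_shift (h : IsCausalVAR A S P) (s t u : ℤ) (a b : Fin d) :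
    cov[fun x => x (s + u) a, fun x => x (t + u) b; P] =
      cov[fun x => x s a, fun x => x t b; P] := by
  have hm : Measurable fun (x : ℤ → EuclideanSpace ℝ (Fin d)) (t : ℤ) => x (t + u) :=
    measurable_pi_iff.2 fun t => measurable_pi_apply (t + u)
  have h1 := covariance_map_fun (μ := P) (Z := fun x (t : ℤ) => x (t + u))
    (X := fun x => x s a) (Y := fun x => x t b)
    (by rw [h.stationary u]; exact (h.memLp_apply s a).1)
    (by rw [h.stationary u]; exact (h.memLp_apply t b).1) hm.aemeasurable
  rw [h.stationary u] at h1
  exact h1.symm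

theorem IsCausalVAR.toeplitz_autocov (h : IsCausalVAR A S P) (n : ℕ) (i k : Fin n)
    (a b : Fin d) (t : ℤ) : toeplitz (autocov P) n (i, a) (k, b) =
      cov[fun x => x (t - i) a, fun x => x (t - k) b; P] := by
  simp only [toeplitz, of_apply, autocov]
  split_ifs with hik
  · have e : -((k.val - i.val : ℕ) : ℤ) + (t - i.val) = t - k.val := by
      have := Fin.le_def.1 hik
      omega
    rw [← h.covariance_shift 0 _ (t - i.val) a b, zero_add, e]
  · have e : -((i.val - k.val : ℕ) : ℤ) + (t - k.val) = t - i.val := by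
      have := Fin.lt_def.1 (not_le.1 hik)
      omega
    rw [covariance_comm, ← h.covariance_shift _ 0 (t - k.val) a b, zero_add, e]

/-- The definition only makes the innovations independent of one another. Orthogonality to the past
follows from the moving average representation of `P`, under which the innovation at `t` is the
noise coordinate. -/
theorem IsCausalVAR.covariance_innovation_past (h : IsCausalVAR A S P) {t u : ℤ} (hut : u < t)
    (a b : Fin d) : cov[fun x => innovation A t x a, fun x => x u b; P] = 0 := by
  have hA := h.isCausalPoly
  have h1 := covariance_map_fun (μ := noiseLaw S) (Z := linearFilter (impulseOp A))
    (X := fun x => innovation A t x a) (Y := fun x => x u b)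
    (by rw [← causalLaw, ← h.eq_causalLaw]; exact (h.memLp_innovation t a).1)
    (by rw [← causalLaw, ← h.eq_causalLaw]; exact (h.memLp_apply u b).1)
    (aemeasurable_linearFilter_noiseLaw hA)
  rw [← causalLaw, ← h.eq_causalLaw] at h1
  rw [h1, ← covariance_linearFilter_noiseLaw (S := S) hA hut a b]
  have h2 : (fun z => innovation A t (linearFilter (impulseOp A) z) a) =ᵐ[noiseLaw S]
      fun z => z t a := by
    filter_upwards [ae_filterSummable_noiseLaw (S := S) hA] with z hz
    rw [innovation_linearFilter A hz]
  rw [covariance, covariance, integral_congr_ae h2]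
  refine integral_congr_ae ?_
  filter_upwards [h2] with z hz
  rw [hz]

theorem IsCausalVAR.covariance_innovation_self (h : IsCausalVAR A S P) (t : ℤ) (a b : Fin d) :
    cov[fun x => innovation A t x a, fun x => innovation A t x b; P] = S a b := by
  have h1 := covariance_map_fun (μ := P) (Z := innovation A t)
    (X := fun y : EuclideanSpace ℝ (Fin d) => y a) (Y := fun y => y b)
    (by fun_prop) (by fun_prop) (measurable_innovation A t).aemeasurable
  rw [h.innovation_law, covariance_eval_multivariateGaussian h.posDef.posSemidef] at h1
  exact h1.symm

theorem IsCausalVAR.covariance_innovation_present (h : IsCausalVAR A S P) (t : ℤ)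
    (a b : Fin d) : cov[fun x => innovation A t x a, fun x => x t b; P] = S a b := by
  rw [covariance_comm, h.covariance_eq t b (h.memLp_innovation t a), covariance_comm,
    h.covariance_innovation_self, add_eq_left]
  refine Finset.sum_eq_zero fun k _ => Finset.sum_eq_zero fun c _ => ?_
  rw [covariance_comm, h.covariance_innovation_past (by omega), mul_zero]

theorem IsCausalVAR.isYuleWalker (h : IsCausalVAR A S P) : IsYuleWalker A S (autocov P) where
  symm_zero := by
    ext a b
    simp only [transpose_apply, autocov, of_apply, Nat.cast_zero, neg_zero]
    exact covariance_comm _ _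
  coeff := by
    ext a ⟨k, b⟩
    rw [coeffRow_mul_apply]
    simp only [transpose_apply, xi, of_apply]
    rw [autocov, of_apply, h.covariance_eq 0 a (h.memLp_apply _ b),
      h.covariance_innovation_past (by omega), zero_add]
    refine Finset.sum_congr rfl fun j _ => Finset.sum_congr rfl fun c _ => ?_
    rw [h.toeplitz_autocov p j k c b (-1), show (0 : ℤ) - (j.val + 1 : ℕ) = -1 - j.val by omega,
      show -((k.val + 1 : ℕ) : ℤ) = -1 - k.val by omega]
  innov := by
    ext a b
    rw [Matrix.add_apply, coeffRow_mul_apply, autocov, of_apply,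
      h.covariance_eq 0 a (h.memLp_apply _ b)]
    simp only [Nat.cast_zero, neg_zero]
    rw [h.covariance_innovation_present, add_comm]
    congr 1
    refine Finset.sum_congr rfl fun j _ => Finset.sum_congr rfl fun c _ => ?_
    rw [covariance_comm]
    simp only [xi, autocov, of_apply, zero_sub]

theorem IsCausalVAR.isLyapunov (h : IsCausalVAR A S P) :
    IsLyapunov A S (toeplitz (autocov P) (p + 1)) := by
  refine h.isYuleWalker.isLyapunov ?_
  simpa [conjTranspose_eq_transpose_of_trivial] using h.posDef.isHermitian.eq

theorem IsCausalVAR.posDef_toeplitz (h : IsCausalVAR A S P) :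
    (toeplitz (autocov P) (p + 1)).PosDef :=
  h.isLyapunov.posDef h.isCausalPoly h.posDef (transpose_toeplitz h.isYuleWalker.symm_zero _)

theorem IsCausalVAR.eq_yuleWalker (h : IsCausalVAR A S P) :
    A = yuleWalker (autocov P) p ∧ S = condC (autocov P) p :=
  h.isYuleWalker.eq_yuleWalker (posDef_toeplitz_of_le p.le_succ h.posDef_toeplitz)

/-- A causal VAR process is determined by its autocovariances up to lag `p`. -/
theorem IsCausalVAR.eq_of_autocov_eq {A' : Fin p → Matrix (Fin d) (Fin d) ℝ}
    {S' : Matrix (Fin d) (Fin d) ℝ} {P' : Measure (ℤ → EuclideanSpace ℝ (Fin d))}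
    (h : IsCausalVAR A S P) (h' : IsCausalVAR A' S' P')
    (he : ∀ k ≤ p, autocov P k = autocov P' k) : A = A' ∧ S = S' ∧ P = P' := by
  have hA : A = A' := by
    rw [h.eq_yuleWalker.1, h'.eq_yuleWalker.1, yuleWalker_congr he]
  have hS : S = S' := by
    rw [h.eq_yuleWalker.2, h'.eq_yuleWalker.2, condC_congr he]
  refine ⟨hA, hS, ?_⟩
  rw [h.eq_causalLaw, h'.eq_causalLaw, hA, hS]

/-- Every positive definite block Toeplitz matrix is the covariance matrix of a causal VAR
process with the Yule-Walker parameters. -/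
theorem exists_isCausalVAR_of_posDef {γ : ℕ → Matrix (Fin d) (Fin d) ℝ}
    (hγ : (toeplitz γ (p + 1)).PosDef) :
    ∃ P, IsCausalVAR (yuleWalker γ p) (condC γ p) P ∧ ∀ k ≤ p, autocov P k = γ k := by
  have hC := condC_posDef le_rfl hγ
  have hL : IsLyapunov (yuleWalker γ p) (condC γ p) (toeplitz γ (p + 1)) := by
    refine (isYuleWalker_yuleWalker hγ).isLyapunov ?_
    simpa [conjTranspose_eq_transpose_of_trivial] using hC.isHermitian.eq
  have hP := isCausalVAR_causalLaw (hL.isCausalPoly hγ hC) hC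
  refine ⟨_, hP, fun k hk => eq_of_toeplitz_eq ?_ hk⟩
  -- Both the constructed process and the prescribed `γ` solve the same Lyapunov equation.
  exact hP.isLyapunov.unique hP.isCausalPoly hL

/-! ### Parametrization by rank factors -/

section factor

variable {r : Fin p → ℕ} {s : ℕ}

theorem rank_condC_inv_sub {γ : ℕ → Matrix (Fin d) (Fin d) ℝ}
    (hγ : (toeplitz γ (p + 1)).PosDef) (j : Fin p) :
    ((condC γ (j + 1))⁻¹ - (condC γ j)⁻¹).rank = (partialCov γ j).rank := by
  have h1 := condC_succ (posDef_toeplitz_of_le (Nat.succ_le_succ j.2.le) hγ)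
  rw [rank_inv_sub_inv (condC_posDef j.2.le hγ).isUnit (condC_posDef j.2 hγ).isUnit, h1,
    sub_sub_cancel, rank_mul_posDef_mul_transpose _ (condD_posDef j.2.le hγ).inv]

/-- Induction through the Levinson update. The contraction is only required once the smaller
Toeplitz matrix is known to be positive definite, because `UᵀC⁻¹U < I` can be converted to Loewner
form only when `C > 0`. -/
theorem FactorParam.posDef_toeplitz_succ (θ : FactorParam d p r) (hΩ : θ.Ω.PosDef) {n : ℕ}
    (hn : n ≤ p)
    (h : ∀ j : Fin p, (j : ℕ) < n → (toeplitz θ.autocov (j + 1)).PosDef →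
      (condC θ.autocov j - (θ.U j * (θ.V j)ᵀ) * (condD θ.autocov j)⁻¹ *
        (θ.U j * (θ.V j)ᵀ)ᵀ).PosDef) : (toeplitz θ.autocov (n + 1)).PosDef := by
  induction n with
  | zero =>
    refine (posDef_toeplitz_succ_iff_condC _ 0).2 ⟨posDef_toeplitz_zero _, ?_⟩
    rw [condC_zero, θ.autocov_zero]
    exact hΩ.inv
  | succ n ih =>
    have h1 := ih (by omega) fun j hj => h j (by omega)
    refine (posDef_toeplitz_succ_iff_condC _ (n + 1)).2 ⟨h1, ?_⟩
    have h2 := h ⟨n, hn⟩ n.lt_succ_self h1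
    rw [condC_succ h1]
    rwa [← θ.partialCov_autocov ⟨n, hn⟩] at h2

theorem FactorParam.IsFeasible.posDef_toeplitz {θ : FactorParam d p r} (h : θ.IsFeasible s) :
    (toeplitz θ.autocov (p + 1)).PosDef :=
  θ.posDef_toeplitz_succ h.posDef le_rfl fun j _ _ => h.contraction j

theorem mul_inv_mul_transpose_of_normalized {l : ℕ} {U V : Matrix (Fin d) (Fin l) ℝ}
    {G : Matrix (Fin d) (Fin d) ℝ} (hV : Vᵀ * G * V = 1) :
    (U * Vᵀ) * G * (U * Vᵀ)ᵀ = U * Uᵀ := by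
  calc (U * Vᵀ) * G * (U * Vᵀ)ᵀ = U * (Vᵀ * G * V) * Uᵀ := by
        simp only [transpose_mul, transpose_transpose, Matrix.mul_assoc]
    _ = U * Uᵀ := by rw [hV, Matrix.mul_one]

theorem FactorParam.IsAdmissible.isFeasible {θ : FactorParam d p r} (h : θ.IsAdmissible s) :
    θ.IsFeasible s := by
  have key : ∀ j : Fin p, (toeplitz θ.autocov (j + 1)).PosDef →
      (condC θ.autocov j - (θ.U j * (θ.V j)ᵀ) * (condD θ.autocov j)⁻¹ *
        (θ.U j * (θ.V j)ᵀ)ᵀ).PosDef := by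
    intro j hj
    rw [mul_inv_mul_transpose_of_normalized (h.normalized j)]
    exact (posDef_sub_mul_transpose_iff (condC_posDef le_rfl hj) _).2 (h.contraction j)
  have hT := θ.posDef_toeplitz_succ h.posDef le_rfl fun j _ => key j
  exact ⟨h.posDef, h.sparse, h.rank_U, h.rank_V, fun j =>
    key j (posDef_toeplitz_of_le (Nat.succ_le_succ j.2.le) hT)⟩

theorem FactorParam.IsFeasible.exists_isCausalVAR {θ : FactorParam d p r}
    (h : θ.IsFeasible s) :
    ∃ P, IsCausalVAR (yuleWalker θ.autocov p) (condC θ.autocov p) P ∧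
      (∀ k ≤ p, VAR.autocov P k = θ.autocov k) ∧
      (∀ j : Fin p, partialCov (VAR.autocov P) j = θ.U j * (θ.V j)ᵀ) ∧
      HasStructure r s P := by
  obtain ⟨P, hP, he⟩ := exists_isCausalVAR_of_posDef h.posDef_toeplitz
  have hW : ∀ j : Fin p, partialCov (VAR.autocov P) j = θ.U j * (θ.V j)ᵀ := fun j => by
    rw [← θ.partialCov_autocov j, partialCov_congr fun k hk => he k (hk.trans j.2)]
  refine ⟨P, hP, he, hW, ?_, fun j => ?_⟩
  · rw [he 0 (Nat.zero_le p), θ.autocov_zero,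
      nonsing_inv_nonsing_inv _ ((isUnit_iff_isUnit_det _).1 h.posDef.isUnit)]
    exact h.sparse
  · rw [rank_condC_inv_sub hP.posDef_toeplitz, hW,
      rank_mul_transpose_of_rank_right ((h.rank_V j).trans (Fintype.card_fin _).symm),
      h.rank_U]

/-- The normalized rank factorization of the partial covariances of a causal VAR process. -/
theorem IsCausalVAR.exists_factorization (h : IsCausalVAR A S P) (hs : HasStructure r s P)
    (j : Fin p) : ∃ U V : Matrix (Fin d) (Fin (r j)) ℝ,
      partialCov (autocov P) j = U * Vᵀ ∧ Vᵀ * (condD (autocov P) j)⁻¹ * V = 1 ∧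
      U.rank = r j ∧ V.rank = r j ∧
      (1 - Uᵀ * (condC (autocov P) j)⁻¹ * U).PosDef := by
  have hT := h.posDef_toeplitz
  have hr : (partialCov (autocov P) j).rank = r j := by
    rw [← rank_condC_inv_sub hT, hs.2 j]
  obtain ⟨U, V, hW, hV⟩ := exists_normalized_factorization (condD_posDef j.2.le hT).inv hr
  rw [hW] at hr
  refine ⟨U, V, hW, hV, rank_left_of_factorization hr, rank_right_of_factorization hr, ?_⟩
  refine (posDef_sub_mul_transpose_iff (condC_posDef j.2.le hT) U).1 ?_
  have h1 := condC_posDef (n := j + 1) j.2 hT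
  rwa [condC_succ (posDef_toeplitz_of_le (Nat.succ_le_succ j.2.le) hT), hW,
    mul_inv_mul_transpose_of_normalized hV] at h1

theorem normalized_factorization_condD_iff {γ : ℕ → Matrix (Fin d) (Fin d) ℝ}
    (hγ : (toeplitz γ (p + 1)).PosDef) (j : Fin p) {W : Matrix (Fin d) (Fin d) ℝ} {l : ℕ}
    {U V : Matrix (Fin d) (Fin l) ℝ} (hW : W = U * Vᵀ) (hU : U.rank = l)
    (hV : Vᵀ * (condD γ j)⁻¹ * V = 1) (U' V' : Matrix (Fin d) (Fin l) ℝ) :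
    (W = U' * V'ᵀ ∧ V'ᵀ * (condD γ j)⁻¹ * V' = 1) ↔
      ∃ Q ∈ orthogonalGroup (Fin l) ℝ, U' = U * Q ∧ V' = V * Q := by
  rw [hW]
  refine normalized_factorization_iff ?_ hU hV
  simpa [conjTranspose_eq_transpose_of_trivial] using
    (condD_posDef j.2.le hγ).inv.isHermitian.eq

/-- Rotated parameters determine the same autocovariances. -/
theorem autocov_eq_of_rotation {θ θ' : {θ : FactorParam d p r // θ.IsAdmissible s}}
    (h : (rotationSetoid d p r s) θ θ') : θ.1.autocov = θ'.1.autocov := by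
  obtain ⟨h0, h⟩ := h
  rw [FactorParam.autocov, FactorParam.autocov, h0]
  congr 1
  funext m
  split_ifs with hm
  · obtain ⟨Q, hQ, hU, hV⟩ := h ⟨m, hm⟩
    rw [hU, hV, transpose_mul, Matrix.mul_assoc, ← Matrix.mul_assoc Q,
      (mem_orthogonalGroup_iff _ _).1 hQ, Matrix.one_mul]
  · rfl

/-- The autoregressive parameters of a rotation class. -/
def paramMap (d p : ℕ) (r : Fin p → ℕ) (s : ℕ) :
    Quotient (rotationSetoid d p r s) → causalParams d p r s :=
  Quotient.lift (fun θ => ⟨(yuleWalker θ.1.autocov p, condC θ.1.autocov p), by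
      obtain ⟨P, hP, -, -, hs⟩ := θ.2.isFeasible.exists_isCausalVAR
      exact ⟨P, hP, hs⟩⟩)
    fun θ θ' h => by simp only [autocov_eq_of_rotation h]

/-- Equal `(A, S)` give the same law, hence the same `Γ(0)` and `W_j`; normalized factors of `W_j`
agree up to rotation. -/
theorem paramMap_injective : Function.Injective (paramMap d p r s) := by
  intro q q' h
  induction q using Quotient.inductionOn with | _ θ => ?_
  induction q' using Quotient.inductionOn with | _ θ' => ?_
  have h1 : (yuleWalker θ.1.autocov p, condC θ.1.autocov p) =
    (yuleWalker θ'.1.autocov p, condC θ'.1.autocov p) := congrArg Subtype.val h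
  obtain ⟨hA, hS⟩ := Prod.ext_iff.1 h1
  obtain ⟨P, hP, he, hW, -⟩ := θ.2.isFeasible.exists_isCausalVAR
  obtain ⟨P', hP', he', hW', -⟩ := θ'.2.isFeasible.exists_isCausalVAR
  have hPP : P = P' := by
    rw [hP.eq_causalLaw, hP'.eq_causalLaw]
    exact congrArg₂ _ hA hS
  subst hPP
  have hγ : ∀ k ≤ p, θ.1.autocov k = θ'.1.autocov k := fun k hk => by
    rw [← he k hk, he' k hk]
  refine Quotient.sound ⟨?_, fun j => ?_⟩
  · have h0 := hγ 0 (Nat.zero_le p)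
    rw [FactorParam.autocov_zero, FactorParam.autocov_zero] at h0
    rw [← nonsing_inv_nonsing_inv θ.1.Ω ((isUnit_iff_isUnit_det _).1 θ.2.posDef.isUnit), h0,
      nonsing_inv_nonsing_inv θ'.1.Ω ((isUnit_iff_isUnit_det _).1 θ'.2.posDef.isUnit)]
  · refine (normalized_factorization_condD_iff θ.2.isFeasible.posDef_toeplitz j (hW j)
      (θ.2.rank_U j) (θ.2.normalized j) _ _).1 ⟨hW' j, ?_⟩
    rw [condD_congr fun k hk => hγ k (hk.trans j.2.le)]
    exact θ'.2.normalized j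

/-- Factors of the partial covariances of a given process, fed into the recursion, reproduce its
autocovariances up to lag `p`. The matrices `C_{j-1}`, `D_{j-1}` and the Yule-Walker parameters then
agree as well. -/
theorem paramMap_surjective : Function.Surjective (paramMap d p r s) := by
  rintro ⟨⟨A, S⟩, P, hP, hs⟩
  dsimp only at hP
  choose U V hW hV hU hVr hC using hP.exists_factorization hs
  set θ : FactorParam d p r := ⟨(autocov P 0)⁻¹, U, V⟩ with hθ
  have h0 : (autocov P 0).PosDef := by
    rw [← condC_zero (autocov P)]
    exact condC_posDef (Nat.zero_le p) hP.posDef_toeplitz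
  have hγ : ∀ k ≤ p, θ.autocov k = autocov P k := by
    refine eq_of_partialCov_eq ?_ fun j hj => ?_
    · rw [θ.autocov_zero]
      exact nonsing_inv_nonsing_inv _ ((isUnit_iff_isUnit_det _).1 h0.isUnit)
    · exact (θ.partialCov_autocov ⟨j, hj⟩).trans (hW ⟨j, hj⟩).symm
  have hθa : θ.IsAdmissible s := by
    refine ⟨h0.inv, hs.1, hU, hVr, fun j => ?_, fun j => ?_⟩
    · rw [condD_congr fun k hk => hγ k (hk.trans j.2.le)]
      exact hV j
    · rw [condC_congr fun k hk => hγ k (hk.trans j.2.le)]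
      exact hC j
  refine ⟨Quotient.mk _ ⟨θ, hθa⟩, Subtype.ext ?_⟩
  change (yuleWalker θ.autocov p, condC θ.autocov p) = (A, S)
  rw [yuleWalker_congr hγ, condC_congr hγ, ← hP.eq_yuleWalker.1, ← hP.eq_yuleWalker.2]

end factor

end VAR

end

theorem mainTheorem4 (d p s : ℕ) (r : Fin p → ℕ) :
    -- the forward direction
    (∀ θ : VAR.FactorParam d p r, θ.IsFeasible s →
      ∃ (A : Fin p → Matrix (Fin d) (Fin d) ℝ) (S : Matrix (Fin d) (Fin d) ℝ)
        (P : Measure (ℤ → EuclideanSpace ℝ (Fin d))),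
        VAR.IsCausalVAR A S P ∧
        VAR.autocov P 0 = θ.Ω⁻¹ ∧
        (∀ j : Fin p, VAR.partialCov (VAR.autocov P) j = θ.U j * (θ.V j)ᵀ) ∧
        (∀ h ≤ p, VAR.autocov P h = θ.autocov h) ∧
        A = VAR.yuleWalker θ.autocov p ∧
        S = VAR.condC θ.autocov p ∧
        (∀ j : Fin p, ((VAR.condC (VAR.autocov P) (j + 1))⁻¹
          - (VAR.condC (VAR.autocov P) j)⁻¹).rank = r j) ∧
        (∀ (A' : Fin p → Matrix (Fin d) (Fin d) ℝ) (S' : Matrix (Fin d) (Fin d) ℝ)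
          (P' : Measure (ℤ → EuclideanSpace ℝ (Fin d))),
          VAR.IsCausalVAR A' S' P' → VAR.autocov P' 0 = θ.Ω⁻¹ →
          (∀ j : Fin p, VAR.partialCov (VAR.autocov P') j = θ.U j * (θ.V j)ᵀ) →
          A' = A ∧ S' = S ∧ P' = P)) ∧
    -- the converse
    (∀ (A : Fin p → Matrix (Fin d) (Fin d) ℝ) (S : Matrix (Fin d) (Fin d) ℝ)
      (P : Measure (ℤ → EuclideanSpace ℝ (Fin d))),
      VAR.IsCausalVAR A S P → VAR.HasStructure r s P →
      ∀ j : Fin p, ∃ (U V : Matrix (Fin d) (Fin (r j)) ℝ),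
        VAR.partialCov (VAR.autocov P) j = U * Vᵀ ∧
        Vᵀ * (VAR.condD (VAR.autocov P) j)⁻¹ * V = 1 ∧
        U.rank = r j ∧ V.rank = r j ∧
        (1 - Uᵀ * (VAR.condC (VAR.autocov P) j)⁻¹ * U).PosDef ∧
        ∀ U' V' : Matrix (Fin d) (Fin (r j)) ℝ,
          (VAR.partialCov (VAR.autocov P) j = U' * V'ᵀ ∧
            V'ᵀ * (VAR.condD (VAR.autocov P) j)⁻¹ * V' = 1) ↔
          ∃ Q ∈ Matrix.orthogonalGroup (Fin (r j)) ℝ, U' = U * Q ∧ V' = V * Q) ∧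
    -- the bijection from rotation classes onto the causal parameter space
    (∃ Φ : Quotient (VAR.rotationSetoid d p r s) → VAR.causalParams d p r s,
      Function.Bijective Φ ∧
      ∀ θ : {θ : VAR.FactorParam d p r // θ.IsAdmissible s},
        (Φ (Quotient.mk (VAR.rotationSetoid d p r s) θ)).1 =
          (VAR.yuleWalker θ.1.autocov p, VAR.condC θ.1.autocov p)) := by
  refine ⟨fun θ hθ => ?_, fun A S P hP hs j => ?_, ?_⟩
  · obtain ⟨P, hP, he, hW, hs⟩ := hθ.exists_isCausalVAR
    have h0 := (he 0 (Nat.zero_le p)).trans θ.autocov_zero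
    refine ⟨_, _, P, hP, h0, hW, he, rfl, rfl, hs.2, fun A' S' P' hP' h0' hW' => ?_⟩
    refine hP'.eq_of_autocov_eq hP (VAR.eq_of_partialCov_eq (h0'.trans h0.symm) fun j hj => ?_)
    exact (hW' ⟨j, hj⟩).trans (hW ⟨j, hj⟩).symm
  · obtain ⟨U, V, hW, hV, hU, hVr, hC⟩ := hP.exists_factorization hs j
    exact ⟨U, V, hW, hV, hU, hVr, hC,
      VAR.normalized_factorization_condD_iff hP.posDef_toeplitz j hW hU hV⟩
  · exact ⟨VAR.paramMap d p r s, ⟨VAR.paramMap_injective, VAR.paramMap_surjective⟩,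
      fun _ => rfl⟩
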